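/- Let $\delta\in\mathbb{C}$ and let $n\geqslant 0$ be an integer. A Brauer diagram on $n$ strands consists of an upper and a lower row of $n$ nodes each, together with a perfect matching of the $2n$ nodes by lines. Lines joining two nodes of the same row are called arcs; a diagram has as many arcs in the upper row as in the lower row, and it is said to contain $f$ arcs if there are $f$ arcs in either row. The Brauer algebra $B_n(\delta)$ is the complex vector space with basis the Brauer diagrams. The product $b_1b_2$ of two diagrams is obtained by placing $b_1$ below $b_2$, identifying the upper nodes of $b_1$ with the lower nodes of $b_2$, omitting the $\ell$ closed loops which arise, straightening the remaining lines, and multiplying the resulting diagram by $\delta^{\ell}$. The diagrams without arcs are the permutation diagrams; they span the subalgebra $\mathbb{C}\mathfrak{S}_n\subset B_n(\delta)$. Let $C_n(\delta)$ be the centraliser of $\mathbb{C}\mathfrak{S}_n$ in $B_n(\delta)$, and for $f\geqslant 0$ let $J^{(f)}\subset B_n(\delta)$ be the two-sided ideal spanned by the diagrams with at least $f$ arcs. Write $C_n(\delta)/J^{(f)}$ for the quotient algebra $C_n(\delta)/(C_n(\delta)\cap J^{(f)})$. **Lemma.** For every $\delta\in\mathbb{C}$ the algebra $C_n(\delta)$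 is commutative for $n\leqslant 5$ and non-commutative for $n\geqslant 6$. Moreover, for every $n\geqslant 6$, with $f_{\max}=\lfloor n/2\rfloor$: i) the quotient algebra $C_n(\delta)/J^{(f)}$ is commutative for $f=1,2$ and non-commutative for $f=3,\dots,f_{\max}$; ii) the subalgebra $C_n(\delta)\cap J^{(f)}$ is commutative for $f=f_{\max}$ and non-commutative for $f=0,\dots,f_{\max}-1$. -/

import Mathlib

namespace Brauer

/-- A Brauer diagram on two rows of `n` nodes: `Sum.inl i` is the `i`-th upper node, `Sum.inr i`
the `i`-th lower node.  Every node is an endpoint of exactly one line, and `line x` is the other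
endpoint of the line at `x`. -/
@[ext]
structure Diagram (n : ℕ) where
  line : Fin n ⊕ Fin n → Fin n ⊕ Fin n
  line_line : ∀ x, line (line x) = x
  line_ne : ∀ x, line x ≠ x

/-- The nodes of two stacked diagrams: the upper row, the common middle row, the lower row. -/
abbrev Stack (n : ℕ) : Type := Fin n ⊕ (Fin n ⊕ Fin n)

/-- The nodes of the diagram placed on top, inside the stack. -/
def topPart {n : ℕ} : Fin n ⊕ Fin n → Stack n
  | .inl i => .inl i
  | .inr i => .inr (.inl i)

/-- The nodes of the diagram placed below, inside the stack. -/
def lowPart {n : ℕ} : Fin n ⊕ Fin n → Stack n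
  | .inl i => .inr (.inl i)
  | .inr i => .inr (.inr i)

/-- The outer (upper and lower) nodes of the stack. -/
def outer {n : ℕ} : Fin n ⊕ Fin n → Stack n
  | .inl i => .inl i
  | .inr i => .inr (.inr i)

/-- In the stack with `b₁` placed below `b₂`, two nodes are endpoints of one line. -/
inductive Adj {n : ℕ} (b₁ b₂ : Diagram n) : Stack n → Stack n → Prop
  | top (x : Fin n ⊕ Fin n) : Adj b₁ b₂ (topPart x) (topPart (b₂.line x))
  | low (x : Fin n ⊕ Fin n) : Adj b₁ b₂ (lowPart x) (lowPart (b₁.line x))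

/-- Connectedness in the stack with `b₁` placed below `b₂`. -/
def conn {n : ℕ} (b₁ b₂ : Diagram n) : Setoid (Stack n) := Relation.EqvGen.setoid (Adj b₁ b₂)

/-- The number of loops: connected components of the stack without outer nodes. -/
noncomputable def loops {n : ℕ} (b₁ b₂ : Diagram n) : ℕ :=
  Nat.card {q : Quotient (conn b₁ b₂) // ¬ ∃ v, Quotient.mk (conn b₁ b₂) (outer v) = q}

section Involutions

variable {X : Type*} [Finite X]

theorem orbit_aux (σ τ : Equiv.Perm X) (hσ : ∀ x, σ (σ x) = x) (hτ : ∀ x, τ (τ x) = x)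
    (hne : ∀ x, ¬ (σ x = x ∧ τ x = x)) (x : X) (hx : τ x = x) :
    ∃! y, y ≠ x ∧ Relation.EqvGen (fun u v => v = σ u ∨ v = τ u) x y ∧ (σ y = y ∨ τ y = y) := by
  have hσ2 : σ⁻¹ = σ := by
    ext y; rw [Equiv.Perm.inv_eq_iff_eq, hσ]
  have hτ2 : τ⁻¹ = τ := by
    ext y; rw [Equiv.Perm.inv_eq_iff_eq, hτ]
  set ρ : Equiv.Perm X := σ * τ with hρ
  have hτρ : ∀ k : ℤ, τ ((ρ ^ k) x) = (ρ ^ (-k)) x := by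
    intro k
    have h1 : τ * ρ ^ k * τ⁻¹ = ρ ^ (-k) := by
      rw [← conj_zpow, zpow_neg, ← inv_zpow]
      congr 1
      rw [hρ, mul_inv_rev, hσ2, hτ2]
      ext y; simp [hτ]
    have := congrArg (fun f : Equiv.Perm X => f x) h1
    simp only [hτ2, Equiv.Perm.mul_apply, hx] at this
    exact this
  have hσρ : ∀ k : ℤ, σ ((ρ ^ k) x) = (ρ ^ (1 - k)) x := by
    intro k
    have : σ ((ρ ^ k) x) = ρ (τ ((ρ ^ k) x)) := by simp [hρ, hτ]
    rw [this, hτρ, ← Equiv.Perm.mul_apply, ← zpow_one_add]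
    rfl
  have hcl : ∀ y, Relation.EqvGen (fun u v => v = σ u ∨ v = τ u) x y ↔ ∃ k : ℤ, y = (ρ ^ k) x := by
    intro y
    constructor
    · intro h
      have key : ∀ u v, Relation.EqvGen (fun u v => v = σ u ∨ v = τ u) u v →
          ((∃ k : ℤ, u = (ρ ^ k) x) ↔ ∃ k : ℤ, v = (ρ ^ k) x) := by
        intro u v h
        induction h with
        | rel u v h =>
          rcases h with rfl | rfl
          · constructor
            · rintro ⟨k, rfl⟩; exact ⟨1 - k, hσρ k⟩
            · rintro ⟨k, hk⟩
              exact ⟨1 - k, by rw [← hσρ, ← hk, hσ]⟩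
          · constructor
            · rintro ⟨k, rfl⟩; exact ⟨-k, hτρ k⟩
            · rintro ⟨k, hk⟩
              exact ⟨-k, by rw [← hτρ, ← hk, hτ]⟩
        | refl => exact Iff.rfl
        | symm _ _ _ ih => exact ih.symm
        | trans _ _ _ _ _ ih1 ih2 => exact ih1.trans ih2
      exact (key x y h).1 ⟨0, rfl⟩
    · rintro ⟨k, rfl⟩
      have step : ∀ u, Relation.EqvGen (fun u v => v = σ u ∨ v = τ u) u (ρ u) := fun u =>
        (Relation.EqvGen.rel _ (τ u) (Or.inr rfl)).trans _ _ _
          (Relation.EqvGen.rel _ _ (Or.inl rfl))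
      induction k with
      | zero => exact Relation.EqvGen.refl _
      | succ k ih =>
        refine ih.trans _ _ _ ?_
        have := step ((ρ ^ (k : ℤ)) x)
        rwa [← Equiv.Perm.mul_apply, ← zpow_one_add, add_comm] at this
      | pred k ih =>
        refine ih.trans _ _ _ ?_
        have := step ((ρ ^ (-(k : ℤ) - 1)) x)
        rw [← Equiv.Perm.mul_apply, ← zpow_one_add, add_sub_cancel] at this
        exact this.symm
  set L : ℕ := Function.minimalPeriod (fun y => ρ • y) x with hL
  have hLpos : 0 < L := by
    apply Function.minimalPeriod_pos_of_mem_periodicPts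
    exact Function.Injective.mem_periodicPts (MulAction.injective ρ) x
  have heq : ∀ a b : ℤ, (ρ ^ a) x = (ρ ^ b) x ↔ (L : ℤ) ∣ a - b := by
    intro a b
    rw [hL, ← MulAction.zpow_smul_eq_iff_minimalPeriod_dvd, Equiv.Perm.smul_def]
    rw [sub_eq_neg_add, zpow_add, Equiv.Perm.mul_apply, zpow_neg, Equiv.Perm.inv_eq_iff_eq]
  have heq0 : ∀ a : ℤ, (ρ ^ a) x = x ↔ (L : ℤ) ∣ a := by
    intro a
    have := heq a 0
    simpa using this
  have hfσ : ∀ k : ℤ, σ ((ρ ^ k) x) = (ρ ^ k) x ↔ (L : ℤ) ∣ 1 - 2 * k := by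
    intro k
    rw [hσρ, heq]
    have : (1 - k - k : ℤ) = 1 - 2 * k := by ring
    rw [this]
  have hfτ : ∀ k : ℤ, τ ((ρ ^ k) x) = (ρ ^ k) x ↔ (L : ℤ) ∣ 2 * k := by
    intro k
    rw [hτρ, heq]
    have : (-k - k : ℤ) = -(2 * k) := by ring
    rw [this, dvd_neg]
  have hL1 : L ≠ 1 := by
    intro h1
    apply hne x
    refine ⟨?_, hx⟩
    have := (hfσ 0).2 (by rw [h1]; simp)
    simpa using this
  rcases Nat.even_or_odd' L with ⟨m, hm | hm⟩
  · refine ⟨(ρ ^ (m : ℤ)) x, ⟨?_, (hcl _).2 ⟨m, rfl⟩, Or.inr ?_⟩, ?_⟩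
    · intro h
      rw [heq0] at h
      have := Int.le_of_dvd (by omega) h
      omega
    · rw [hfτ, hm]; push_cast; exact dvd_rfl
    · rintro y ⟨hy, hc, hf⟩
      obtain ⟨k, rfl⟩ := (hcl _).1 hc
      rw [hfσ, hfτ] at hf
      rw [Ne, heq0] at hy
      rw [heq]
      rcases hf with ⟨c, hc⟩ | ⟨c, hc⟩
      · exfalso
        rw [hm] at hc
        have : (1 : ℤ) = 2 * (m * c + k) := by push_cast at hc; linarith
        omega
      · rw [hm] at hc hy ⊢
        push_cast at hc hy ⊢
        have hk : k = m * c := by linarith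
        rcases Int.even_or_odd' c with ⟨d, rfl | rfl⟩
        · exact absurd ⟨d, by rw [hk]; ring⟩ hy
        · exact ⟨d, by rw [hk]; ring⟩
  · refine ⟨(ρ ^ ((m : ℤ) + 1)) x, ⟨?_, (hcl _).2 ⟨_, rfl⟩, Or.inl ?_⟩, ?_⟩
    · intro h
      rw [heq0] at h
      have := Int.le_of_dvd (by omega) h
      omega
    · rw [hfσ, hm]; push_cast; exact ⟨-1, by ring⟩
    · rintro y ⟨hy, hc, hf⟩
      obtain ⟨k, rfl⟩ := (hcl _).1 hc
      rw [hfσ, hfτ] at hf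
      rw [Ne, heq0] at hy
      rw [heq]
      have h2 : IsCoprime (L : ℤ) 2 := by
        rw [hm]; push_cast; exact ⟨1, -m, by ring⟩
      rcases hf with hc | hc
      · apply h2.dvd_of_dvd_mul_left
        have : 2 * (k - (m + 1)) = -(1 - 2 * k) - (L : ℤ) := by rw [hm]; push_cast; ring
        rw [this]
        exact dvd_sub (dvd_neg.2 hc) dvd_rfl
      · exact absurd (h2.dvd_of_dvd_mul_left hc) hy

end Involutions

section Product

variable {n : ℕ}

/-- The lines of the lower diagram, as an involution of the stack. -/
def lowFun (b : Diagram n) : Stack n → Stack n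
  | .inl i => .inl i
  | .inr z => lowPart (b.line z)

/-- The lines of the upper diagram, as an involution of the stack. -/
def topFun (b : Diagram n) : Stack n → Stack n
  | .inl i => topPart (b.line (.inl i))
  | .inr (.inl i) => topPart (b.line (.inr i))
  | .inr (.inr i) => .inr (.inr i)

theorem lowPart_eq (x : Fin n ⊕ Fin n) : lowPart x = .inr x := by cases x <;> rfl

theorem lowFun_lowPart (b : Diagram n) (x) : lowFun b (lowPart x) = lowPart (b.line x) := by
  rw [lowPart_eq]; rfl

theorem topFun_topPart (b : Diagram n) (x) : topFun b (topPart x) = topPart (b.line x) := by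
  cases x <;> rfl

theorem topPart_injective : Function.Injective (topPart (n := n)) := by
  rintro (i | i) (j | j) h <;> simp_all [topPart]

theorem outer_injective : Function.Injective (outer (n := n)) := by
  rintro (i | i) (j | j) h <;> simp_all [outer]

theorem lowFun_lowFun (b : Diagram n) (x) : lowFun b (lowFun b x) = x := by
  rcases x with i | z
  · rfl
  · change lowFun b (lowPart (b.line z)) = _
    rw [lowFun_lowPart, b.line_line, lowPart_eq]

theorem topFun_topFun (b : Diagram n) (x) : topFun b (topFun b x) = x := by
  rcases x with i | i | i
  · change topFun b (topPart (b.line _)) = _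
    rw [topFun_topPart, b.line_line]; rfl
  · change topFun b (topPart (b.line _)) = _
    rw [topFun_topPart, b.line_line]; rfl
  · rfl

theorem lowFun_fixed (b : Diagram n) (x) : lowFun b x = x ↔ ∃ i, x = .inl i := by
  rcases x with i | z
  · simp [lowFun]
  · simp [lowFun, lowPart_eq, b.line_ne]

theorem topFun_fixed (b : Diagram n) (x) : topFun b x = x ↔ ∃ i, x = .inr (.inr i) := by
  rcases x with i | i | i
  · have : topFun b (.inl i) ≠ topPart (.inl i) := fun h =>
      b.line_ne _ (topPart_injective h)
    simpa [topPart] using this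
  · have : topFun b (.inr (.inl i)) ≠ topPart (.inr i) := fun h =>
      b.line_ne _ (topPart_injective h)
    simpa [topPart] using this
  · simp [topFun]

theorem outer_iff (b₁ b₂ : Diagram n) (x) :
    (∃ v, x = outer v) ↔ (lowFun b₁ x = x ∨ topFun b₂ x = x) := by
  rw [lowFun_fixed, topFun_fixed]
  simp [outer]

theorem conn_iff (b₁ b₂ : Diagram n) (x y : Stack n) :
    conn b₁ b₂ x y ↔
      Relation.EqvGen (fun u v => v = lowFun b₁ u ∨ v = topFun b₂ u) x y := by
  constructor
  · intro h
    change Relation.EqvGen (Adj b₁ b₂) x y at h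
    refine Relation.EqvGen.mono ?_ _ _ h
    rintro u v (⟨x⟩ | ⟨x⟩)
    · exact Or.inr (topFun_topPart _ _).symm
    · exact Or.inl (lowFun_lowPart _ _).symm
  · intro h
    change Relation.EqvGen (Adj b₁ b₂) x y
    induction h with
    | rel u v h =>
      rcases h with rfl | rfl
      · rcases u with i | z
        · exact Relation.EqvGen.refl _
        · have := Relation.EqvGen.rel _ _ (Adj.low (b₁ := b₁) (b₂ := b₂) z)
          rwa [lowPart_eq z] at this
      · rcases u with i | i | i
        · exact Relation.EqvGen.rel _ _ (Adj.top (b₁ := b₁) (b₂ := b₂) (.inl i))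
        · exact Relation.EqvGen.rel _ _ (Adj.top (b₁ := b₁) (b₂ := b₂) (.inr i))
        · exact Relation.EqvGen.refl _
    | refl => exact Relation.EqvGen.refl _
    | symm _ _ _ ih => exact ih.symm
    | trans _ _ _ _ _ ih1 ih2 => exact ih1.trans _ _ _ ih2

theorem existsUnique_end (b₁ b₂ : Diagram n) (x : Fin n ⊕ Fin n) :
    ∃! y, y ≠ x ∧ conn b₁ b₂ (outer x) (outer y) := by
  have main : ∃! y : Stack n, y ≠ outer x ∧
      Relation.EqvGen (fun u v => v = lowFun b₁ u ∨ v = topFun b₂ u) (outer x) y ∧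
      (lowFun b₁ y = y ∨ topFun b₂ y = y) := by
    have hne : ∀ z : Stack n, ¬ (lowFun b₁ z = z ∧ topFun b₂ z = z) := by
      rintro z ⟨h1, h2⟩
      obtain ⟨i, rfl⟩ := (lowFun_fixed _ _).1 h1
      obtain ⟨j, hj⟩ := (topFun_fixed _ _).1 h2
      cases hj
    let σ : Equiv.Perm (Stack n) := ⟨lowFun b₁, lowFun b₁, lowFun_lowFun b₁, lowFun_lowFun b₁⟩
    let τ : Equiv.Perm (Stack n) := ⟨topFun b₂, topFun b₂, topFun_topFun b₂, topFun_topFun b₂⟩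
    rcases (outer_iff b₁ b₂ (outer x)).1 ⟨x, rfl⟩ with h | h
    · have := orbit_aux τ σ (topFun_topFun b₂) (lowFun_lowFun b₁)
        (fun z hz => hne z hz.symm) (outer x) h
      simp only [or_comm (a := _ = τ _), or_comm (a := τ _ = _)] at this
      exact this
    · exact orbit_aux σ τ (lowFun_lowFun b₁) (topFun_topFun b₂) hne (outer x) h
  obtain ⟨y, ⟨h1, h2, h3⟩, h4⟩ := main
  obtain ⟨v, rfl⟩ := (outer_iff b₁ b₂ y).2 h3
  refine ⟨v, ⟨fun h => h1 (h ▸ rfl), (conn_iff _ _ _ _).2 h2⟩, ?_⟩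
  rintro w ⟨hw, hc⟩
  apply outer_injective
  exact h4 _ ⟨fun h => hw (outer_injective h), (conn_iff _ _ _ _).1 hc,
    (outer_iff _ _ _).1 ⟨w, rfl⟩⟩

/-- The diagram obtained by placing `b₁` below `b₂`, omitting the loops and straightening the
lines: each outer node is joined to the other outer node of its connected component. -/
noncomputable def comp (b₁ b₂ : Diagram n) : Diagram n where
  line x := (existsUnique_end b₁ b₂ x).choose
  line_line x := by
    have h := (existsUnique_end b₁ b₂ x).choose_spec.1
    exact ((existsUnique_end b₁ b₂ _).choose_spec.2 x ⟨h.1.symm, (conn b₁ b₂).symm h.2⟩).symm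
  line_ne x := (existsUnique_end b₁ b₂ x).choose_spec.1.1

theorem comp_line_iff (b₁ b₂ : Diagram n) (x y : Fin n ⊕ Fin n) :
    (comp b₁ b₂).line x = y ↔ y ≠ x ∧ conn b₁ b₂ (outer x) (outer y) := by
  constructor
  · rintro rfl; exact (existsUnique_end b₁ b₂ x).choose_spec.1
  · intro h; exact ((existsUnique_end b₁ b₂ x).choose_spec.2 y h).symm

/-- The permutation diagram of `s`: the `i`-th upper node is joined with the `s i`-th lower node. -/
def perm (s : Equiv.Perm (Fin n)) : Diagram n where
  line
    | .inl i => .inr (s i)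
    | .inr i => .inl (s.symm i)
  line_line := by rintro (i | i) <;> simp
  line_ne := by rintro (i | i) <;> simp

/-! ### Associativity, through colourings of the nodes -/

open Classical in
/-- The matrix of a diagram: rows and columns are colourings of the upper and of the lower row,
and the entry is `1` if the ends of every line have the same colour, else `0`. -/
noncomputable def colMat (κ : Type) (b : Diagram n) : Matrix (Fin n → κ) (Fin n → κ) ℕ :=
  fun x y => if ∀ v, Sum.elim x y (b.line v) = Sum.elim x y v then 1 else 0

theorem good_iff {κ : Type} (b₁ b₂ : Diagram n) (x m y : Fin n → κ) :
    ((∀ v, Sum.elim x m (b₂.line v) = Sum.elim x m v) ∧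
      (∀ v, Sum.elim m y (b₁.line v) = Sum.elim m y v)) ↔
    ∀ u v, conn b₁ b₂ u v →
      Sum.elim x (Sum.elim m y) u = (Sum.elim x (Sum.elim m y) v : κ) := by
  have ht : ∀ v, Sum.elim x (Sum.elim m y) (topPart v) = Sum.elim x m v := by
    rintro (i | i) <;> rfl
  have hl : ∀ v, Sum.elim x (Sum.elim m y) (lowPart v) = Sum.elim m y v := by
    rintro (i | i) <;> rfl
  constructor
  · rintro ⟨h2, h1⟩ u v h
    change Relation.EqvGen (Adj b₁ b₂) u v at h
    induction h with
    | rel u v h =>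
      rcases h with ⟨z⟩ | ⟨z⟩
      · rw [ht, ht, h2]
      · rw [hl, hl, h1]
    | refl => rfl
    | symm _ _ _ ih => exact ih.symm
    | trans _ _ _ _ _ ih1 ih2 => exact ih1.trans ih2
  · intro h
    constructor
    · intro v
      rw [← ht, ← ht]
      exact (h _ _ (Relation.EqvGen.rel _ _ (Adj.top v))).symm
    · intro v
      rw [← hl, ← hl]
      exact (h _ _ (Relation.EqvGen.rel _ _ (Adj.low v))).symm

open Classical in
theorem colMat_mul {κ : Type} [Fintype κ] (b₁ b₂ : Diagram n) :
    colMat κ b₂ * colMat κ b₁ = (Fintype.card κ ^ loops b₁ b₂) • colMat κ (comp b₁ b₂) := by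
  ext x y
  rw [Matrix.mul_apply, Matrix.smul_apply]
  have h1 : ∀ m : Fin n → κ, colMat κ b₂ x m * colMat κ b₁ m y =
      if (∀ u v, conn b₁ b₂ u v →
        Sum.elim x (Sum.elim m y) u = (Sum.elim x (Sum.elim m y) v : κ)) then 1 else 0 := by
    intro m
    by_cases h2 : ∀ v, Sum.elim x m (b₂.line v) = Sum.elim x m v
    · by_cases h1 : ∀ v, Sum.elim m y (b₁.line v) = Sum.elim m y v
      · rw [if_pos ((good_iff b₁ b₂ x m y).1 ⟨h2, h1⟩)]
        simp only [colMat, if_pos h2, if_pos h1, mul_one]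
      · rw [if_neg (fun h => h1 ((good_iff b₁ b₂ x m y).2 h).2)]
        simp only [colMat, if_neg h1, mul_zero]
    · rw [if_neg (fun h => h2 ((good_iff b₁ b₂ x m y).2 h).1)]
      simp only [colMat, if_neg h2, zero_mul]
  simp only [h1]
  rw [Finset.sum_boole]
  have ho : ∀ (m : Fin n → κ) v, Sum.elim x (Sum.elim m y) (outer v) = Sum.elim x y v := by
    intro m; rintro (i | i) <;> rfl
  by_cases hc : ∀ v, Sum.elim x y ((comp b₁ b₂).line v) = Sum.elim x y v
  · have hout : ∀ u v, conn b₁ b₂ (outer u) (outer v) → Sum.elim x y u = Sum.elim x y v := by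
      intro u v h
      by_cases huv : v = u
      · rw [huv]
      · rw [← (comp_line_iff b₁ b₂ u v).2 ⟨huv, h⟩, hc]
    simp only [colMat, hc, implies_true, if_true, smul_eq_mul, mul_one, Nat.cast_id]
    let Q := Quotient (conn b₁ b₂)
    let P : Q → Prop := fun q => ∃ v, Quotient.mk (conn b₁ b₂) (outer v) = q
    let x₀ : {q : Q // P q} → κ := fun q => Sum.elim x y q.2.choose
    have hx₀ : ∀ v (h : P (Quotient.mk (conn b₁ b₂) (outer v))),
        x₀ ⟨Quotient.mk (conn b₁ b₂) (outer v), h⟩ = Sum.elim x y v := by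
      intro v h
      exact hout _ _ (Quotient.exact h.choose_spec)
    let e : {m : Fin n → κ // ∀ u v, conn b₁ b₂ u v →
        Sum.elim x (Sum.elim m y) u = (Sum.elim x (Sum.elim m y) v : κ)} ≃
        {F : Q → κ // F ∘ Subtype.val = x₀} :=
      { toFun := fun m => ⟨Quotient.lift (Sum.elim x (Sum.elim m.1 y)) m.2, by
          funext ⟨q, v, hv⟩
          subst hv
          rw [hx₀]
          exact ho _ _⟩
        invFun := fun F => ⟨fun i => F.1 (Quotient.mk _ (.inr (.inl i))), by
          have hF : ∀ u, Sum.elim x (Sum.elim (fun i => F.1 (Quotient.mk _ (.inr (.inl i)))) y) u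
              = F.1 (Quotient.mk _ u) := by
            have hF2 : ∀ v, F.1 (Quotient.mk _ (outer v)) = Sum.elim x y v := by
              intro v
              rw [← hx₀ v ⟨v, rfl⟩]
              exact congrFun F.2 ⟨_, v, rfl⟩
            rintro (i | i | i)
            · exact (hF2 (.inl i)).symm
            · rfl
            · exact (hF2 (.inr i)).symm
          intro u v h
          rw [hF, hF, Quotient.sound (s := conn b₁ b₂) h]⟩
        left_inv := fun m => by
          apply Subtype.ext
          funext i
          rfl
        right_inv := fun F => by
          apply Subtype.ext
          funext q
          induction q using Quotient.inductionOn with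
          | h u =>
            have hF2 : ∀ v, F.1 (Quotient.mk _ (outer v)) = Sum.elim x y v := by
              intro v
              rw [← hx₀ v ⟨v, rfl⟩]
              exact congrFun F.2 ⟨_, v, rfl⟩
            rcases u with i | i | i
            · exact (hF2 (.inl i)).symm
            · rfl
            · exact (hF2 (.inr i)).symm }
    rw [← Fintype.card_subtype, ← Nat.card_eq_fintype_card,
      Nat.card_congr (e.trans (Equiv.subtypePreimage P x₀)), Nat.card_fun,
      Nat.card_eq_fintype_card (α := κ)]
    rfl
  · rw [Finset.filter_eq_empty_iff.2]
    · simp only [colMat, if_neg hc, Finset.card_empty, Nat.cast_zero, smul_zero]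
    · intro m _ hm
      apply hc
      intro v
      rw [← ho m, ← ho m]
      exact hm _ _ ((conn b₁ b₂).symm ((comp_line_iff b₁ b₂ v _).1 rfl).2)

theorem colMat_const (b : Diagram n) : colMat Bool b (fun _ => true) (fun _ => true) = 1 := by
  have : ∀ v, Sum.elim (fun _ : Fin n => true) (fun _ : Fin n => true) v = true := by
    rintro (i | i) <;> rfl
  simp [colMat, this]

theorem colMat_injective : Function.Injective (colMat (n := n) Bool) := by
  classical
  intro a b h
  ext1
  funext v
  by_contra hab
  let c : Fin n ⊕ Fin n → Bool := fun w => decide (w = v ∨ w = a.line v)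
  have hc : Sum.elim (c ∘ Sum.inl) (c ∘ Sum.inr) = c := Sum.elim_comp_inl_inr c
  have ha : colMat Bool a (c ∘ Sum.inl) (c ∘ Sum.inr) = 1 := by
    unfold colMat
    rw [if_pos]
    intro w
    rw [hc]
    simp only [c, decide_eq_decide]
    constructor
    · rintro (h | h)
      · right; rw [← h, a.line_line]
      · left; rw [← a.line_line w, h, a.line_line]
    · rintro (h | h)
      · right; rw [h]
      · left; rw [h, a.line_line]
  rw [h] at ha
  unfold colMat at ha
  split_ifs at ha with hb
  · have := hb v
    rw [hc] at this
    simp [c, b.line_ne, Ne.symm hab] at this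

theorem eq_of_smul_colMat {k l : ℕ} {a b : Diagram n}
    (h : (2 ^ k : ℕ) • colMat Bool a = (2 ^ l : ℕ) • colMat Bool b) : k = l ∧ a = b := by
  have hkl : k = l := by
    have := congrFun (congrFun h (fun _ => true)) (fun _ => true)
    simp only [Matrix.smul_apply, colMat_const, smul_eq_mul, mul_one] at this
    exact Nat.pow_right_injective le_rfl this
  refine ⟨hkl, colMat_injective ?_⟩
  subst hkl
  ext x y
  have := congrFun (congrFun h x) y
  simp only [Matrix.smul_apply, smul_eq_mul] at this
  exact Nat.eq_of_mul_eq_mul_left (by positivity) this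

theorem assoc_aux (a b c : Diagram n) :
    loops a b + loops (comp a b) c = loops b c + loops a (comp b c) ∧
      comp (comp a b) c = comp a (comp b c) := by
  apply eq_of_smul_colMat
  have h := Matrix.mul_assoc (colMat Bool c) (colMat Bool b) (colMat Bool a)
  simp only [colMat_mul, Matrix.smul_mul, Matrix.mul_smul, smul_smul, Fintype.card_bool,
    ← pow_add] at h
  exact h.symm

theorem colMat_one : colMat (n := n) Bool (perm 1) = 1 := by
  classical
  ext x y
  have : (∀ v, Sum.elim x y ((perm 1).line v) = Sum.elim x y v) ↔ x = y := by
    constructor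
    · intro h; funext i; exact (h (.inl i)).symm
    · rintro rfl (i | i) <;> rfl
  simp only [colMat, this, Matrix.one_apply]

theorem one_comp_aux (b : Diagram n) : loops (perm 1) b = 0 ∧ comp (perm 1) b = b := by
  apply eq_of_smul_colMat
  have h := colMat_mul (κ := Bool) (perm 1) b
  rw [colMat_one, mul_one, Fintype.card_bool] at h
  rw [← h, pow_zero, one_smul]

theorem comp_one_aux (b : Diagram n) : loops b (perm 1) = 0 ∧ comp b (perm 1) = b := by
  apply eq_of_smul_colMat
  have h := colMat_mul (κ := Bool) b (perm 1)
  rw [colMat_one, one_mul, Fintype.card_bool] at h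
  rw [← h, pow_zero, one_smul]

end Product

/-- The Brauer algebra `B_n(δ)`: the complex vector space with basis the Brauer diagrams. -/
def Alg (n : ℕ) (_δ : ℂ) : Type := Diagram n →₀ ℂ

namespace Alg

variable {n : ℕ} {δ : ℂ}

noncomputable instance : AddCommGroup (Alg n δ) := inferInstanceAs (AddCommGroup (Diagram n →₀ ℂ))

noncomputable instance : Module ℂ (Alg n δ) := inferInstanceAs (Module ℂ (Diagram n →₀ ℂ))

/-- A diagram as a basis vector of the Brauer algebra. -/
noncomputable def diag (δ : ℂ) (b : Diagram n) : Alg n δ := Finsupp.single b (1 : ℂ)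

/-- The basis of diagrams. -/
noncomputable def basis (n : ℕ) (δ : ℂ) : Module.Basis (Diagram n) ℂ (Alg n δ) :=
  Module.Basis.ofRepr (LinearEquiv.refl ℂ (Diagram n →₀ ℂ))

theorem basis_apply (b : Diagram n) : basis n δ b = diag δ b := rfl

/-- The bilinear product, given on diagrams by `b₁ b₂ = δ ^ (number of loops) • comp b₁ b₂`. -/
noncomputable def mulLin (n : ℕ) (δ : ℂ) : Alg n δ →ₗ[ℂ] Alg n δ →ₗ[ℂ] Alg n δ :=
  (basis n δ).constr ℂ fun b₁ => (basis n δ).constr ℂ fun b₂ =>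
    δ ^ loops b₁ b₂ • diag δ (comp b₁ b₂)

noncomputable instance : Mul (Alg n δ) := ⟨fun x y => mulLin n δ x y⟩

noncomputable instance : One (Alg n δ) := ⟨diag δ (perm 1)⟩

theorem mul_def (x y : Alg n δ) : x * y = mulLin n δ x y := rfl

theorem one_def : (1 : Alg n δ) = diag δ (perm 1) := rfl

theorem diag_mul_diag (b₁ b₂ : Diagram n) :
    diag δ b₁ * diag δ b₂ = δ ^ loops b₁ b₂ • diag δ (comp b₁ b₂) := by
  rw [mul_def, mulLin, ← basis_apply b₁, Module.Basis.constr_basis, ← basis_apply b₂,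
    Module.Basis.constr_basis]

theorem mul_assoc' (x y z : Alg n δ) : x * y * z = x * (y * z) := by
  have h : (mulLin n δ).compr₂ (mulLin n δ) =
      ((LinearMap.lcomp ℂ (Alg n δ →ₗ[ℂ] Alg n δ) (mulLin n δ)).comp
        ((LinearMap.llcomp ℂ (Alg n δ) (Alg n δ) (Alg n δ)).comp (mulLin n δ))) := by
    refine (basis n δ).ext fun a => (basis n δ).ext fun b => (basis n δ).ext fun c => ?_
    simp only [LinearMap.compr₂_apply, LinearMap.comp_apply, LinearMap.lcomp_apply,
      LinearMap.llcomp_apply, basis_apply, ← mul_def]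
    rw [diag_mul_diag, diag_mul_diag]
    simp only [mul_def, map_smul, LinearMap.smul_apply]
    simp only [← mul_def, diag_mul_diag, smul_smul, ← pow_add]
    rw [(assoc_aux a b c).1, (assoc_aux a b c).2]
  exact LinearMap.congr_fun (LinearMap.congr_fun (LinearMap.congr_fun h x) y) z

theorem one_mul' (x : Alg n δ) : 1 * x = x := by
  have h : mulLin n δ 1 = LinearMap.id := by
    refine (basis n δ).ext fun a => ?_
    rw [← mul_def, basis_apply, one_def, diag_mul_diag, (one_comp_aux a).1, (one_comp_aux a).2]
    simp
  exact LinearMap.congr_fun h x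

theorem mul_one' (x : Alg n δ) : x * 1 = x := by
  have h : (mulLin n δ).flip 1 = LinearMap.id := by
    refine (basis n δ).ext fun a => ?_
    rw [LinearMap.flip_apply, ← mul_def, basis_apply, one_def, diag_mul_diag,
      (comp_one_aux a).1, (comp_one_aux a).2]
    simp
  exact LinearMap.congr_fun h x

noncomputable instance : Ring (Alg n δ) :=
  { (inferInstance : AddCommGroup (Alg n δ)), (inferInstance : Mul (Alg n δ)),
    (inferInstance : One (Alg n δ)) with
    left_distrib := fun x y z => map_add (mulLin n δ x) y z
    right_distrib := fun x y z => LinearMap.map_add₂ (mulLin n δ) x y z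
    zero_mul := fun x => LinearMap.map_zero₂ (mulLin n δ) x
    mul_zero := fun x => map_zero (mulLin n δ x)
    mul_assoc := mul_assoc'
    one_mul := one_mul'
    mul_one := mul_one' }

noncomputable instance : Algebra ℂ (Alg n δ) :=
  Algebra.ofModule (fun r x y => LinearMap.map_smul₂ (mulLin n δ) r x y)
    (fun r x y => map_smul (mulLin n δ x) r y)

end Alg

section Arcs

variable {n : ℕ}

/-- The number of arcs in the upper row. -/
def upperArcs (b : Diagram n) : ℕ :=
  (Finset.univ.filter fun p : Fin n × Fin n => p.1 < p.2 ∧ b.line (.inl p.1) = .inl p.2).card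

/-- The number of arcs in the lower row. -/
def lowerArcs (b : Diagram n) : ℕ :=
  (Finset.univ.filter fun p : Fin n × Fin n => p.1 < p.2 ∧ b.line (.inr p.1) = .inr p.2).card

theorem arcs_count (φ : Fin n → Fin n ⊕ Fin n) (hφ : Function.Injective φ) (b : Diagram n) :
    2 * (Finset.univ.filter fun p : Fin n × Fin n => p.1 < p.2 ∧ b.line (φ p.1) = φ p.2).card =
      (Finset.univ.filter fun i : Fin n => ∃ j, b.line (φ i) = φ j).card := by
  classical
  have h1 : (Finset.univ.filter fun p : Fin n × Fin n => p.1 < p.2 ∧ b.line (φ p.1) = φ p.2).card =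
      (Finset.univ.filter fun p : Fin n × Fin n => p.2 < p.1 ∧ b.line (φ p.1) = φ p.2).card := by
    refine Finset.card_bij' (fun p _ => p.swap) (fun p _ => p.swap) ?_ ?_ ?_ ?_
    · rintro ⟨i, j⟩ h
      simp only [Finset.mem_filter, Finset.mem_univ, true_and, Prod.fst_swap, Prod.snd_swap] at h ⊢
      exact ⟨h.1, by rw [← h.2, b.line_line]⟩
    · rintro ⟨i, j⟩ h
      simp only [Finset.mem_filter, Finset.mem_univ, true_and, Prod.fst_swap, Prod.snd_swap] at h ⊢
      exact ⟨h.1, by rw [← h.2, b.line_line]⟩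
    · intro p _; exact Prod.swap_swap p
    · intro p _; exact Prod.swap_swap p
  have h2 : (Finset.univ.filter fun p : Fin n × Fin n => b.line (φ p.1) = φ p.2).card =
      (Finset.univ.filter fun i : Fin n => ∃ j, b.line (φ i) = φ j).card := by
    refine Finset.card_bij (fun p _ => p.1) ?_ ?_ ?_
    · rintro ⟨i, j⟩ h
      simp only [Finset.mem_filter, Finset.mem_univ, true_and] at h ⊢
      exact ⟨j, h⟩
    · rintro ⟨i, j⟩ h ⟨i', j'⟩ h' hi
      simp only [Finset.mem_filter, Finset.mem_univ, true_and] at h h' hi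
      subst hi
      rw [hφ (h.symm.trans h')]
    · intro i h
      simp only [Finset.mem_filter, Finset.mem_univ, true_and] at h
      obtain ⟨j, hj⟩ := h
      exact ⟨(i, j), by simpa using hj, rfl⟩
  rw [← h2, two_mul]
  nth_rewrite 2 [h1]
  rw [← Finset.card_union_of_disjoint]
  · congr 1
    ext ⟨i, j⟩
    simp only [Finset.mem_union, Finset.mem_filter, Finset.mem_univ, true_and]
    constructor
    · rintro (h | h) <;> exact h.2
    · intro h
      rcases lt_trichotomy i j with hij | hij | hij
      · exact Or.inl ⟨hij, h⟩
      · subst hij; exact absurd h (b.line_ne _)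
      · exact Or.inr ⟨hij, h⟩
  · rw [Finset.disjoint_left]
    rintro ⟨i, j⟩ h h'
    simp only [Finset.mem_filter, Finset.mem_univ, true_and] at h h'
    exact lt_asymm h.1 h'.1

theorem upperArcs_eq_lowerArcs (b : Diagram n) : upperArcs b = lowerArcs b := by
  classical
  have hu : 2 * upperArcs b = _ := arcs_count Sum.inl Sum.inl_injective b
  have hl : 2 * lowerArcs b = _ := arcs_count Sum.inr Sum.inr_injective b
  have h1 := Finset.card_filter_add_card_filter_not (s := (Finset.univ : Finset (Fin n)))
    (fun i => ∃ j, b.line (.inl i) = .inl j)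
  have h2 := Finset.card_filter_add_card_filter_not (s := (Finset.univ : Finset (Fin n)))
    (fun i => ∃ j, b.line (.inr i) = .inr j)
  have h3 : (Finset.univ.filter fun i : Fin n => ¬ ∃ j, b.line (.inl i) = .inl j).card =
      (Finset.univ.filter fun i : Fin n => ¬ ∃ j, b.line (.inr i) = .inr j).card := by
    have key : ∀ i, (¬ ∃ j, b.line (.inl i) = .inl j) ↔ ∃ j, b.line (.inl i) = .inr j := by
      intro i; rcases b.line (.inl i) with j | j <;> simp
    have key' : ∀ i, (¬ ∃ j, b.line (.inr i) = .inr j) ↔ ∃ j, b.line (.inr i) = .inl j := by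
      intro i; rcases b.line (.inr i) with j | j <;> simp
    simp only [key, key']
    refine Finset.card_bij (fun i h => (Finset.mem_filter.1 h).2.choose) ?_ ?_ ?_
    · intro i h
      have := (Finset.mem_filter.1 h).2.choose_spec
      exact Finset.mem_filter.2 ⟨Finset.mem_univ _, i, by rw [← this, b.line_line]⟩
    · intro i h i' h' e
      have h1 := (Finset.mem_filter.1 h).2.choose_spec
      have h2 := (Finset.mem_filter.1 h').2.choose_spec
      rw [e, ← h2] at h1
      have := congrArg b.line h1
      rw [b.line_line, b.line_line] at this
      exact Sum.inl_injective this
    · intro j h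
      obtain ⟨i, hi⟩ := (Finset.mem_filter.1 h).2
      have hi' : b.line (.inl i) = .inr j := by rw [← hi, b.line_line]
      have hm : i ∈ Finset.univ.filter fun i : Fin n => ∃ j, b.line (.inl i) = .inr j :=
        Finset.mem_filter.2 ⟨Finset.mem_univ _, j, hi'⟩
      exact ⟨i, hm, Sum.inr_injective ((Finset.mem_filter.1 hm).2.choose_spec.symm.trans hi')⟩
  omega

theorem upperArcs_le_comp (b₁ b₂ : Diagram n) : upperArcs b₂ ≤ upperArcs (comp b₁ b₂) := by
  refine Finset.card_le_card fun p hp => ?_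
  simp only [Finset.mem_filter, Finset.mem_univ, true_and] at hp ⊢
  refine ⟨hp.1, (comp_line_iff _ _ _ _).2 ⟨fun h => hp.1.ne' (Sum.inl_injective h), ?_⟩⟩
  have := Adj.top (b₁ := b₁) (b₂ := b₂) (.inl p.1)
  rw [hp.2] at this
  exact Relation.EqvGen.rel _ _ this

theorem lowerArcs_le_comp (b₁ b₂ : Diagram n) : lowerArcs b₁ ≤ lowerArcs (comp b₁ b₂) := by
  refine Finset.card_le_card fun p hp => ?_
  simp only [Finset.mem_filter, Finset.mem_univ, true_and] at hp ⊢
  refine ⟨hp.1, (comp_line_iff _ _ _ _).2 ⟨fun h => hp.1.ne' (Sum.inr_injective h), ?_⟩⟩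
  have := Adj.low (b₁ := b₁) (b₂ := b₂) (.inr p.1)
  rw [hp.2] at this
  exact Relation.EqvGen.rel _ _ this

/-- The span of all diagrams with at least `f` arcs (in either of their rows). -/
noncomputable def arcSpan (n : ℕ) (δ : ℂ) (f : ℕ) : Submodule ℂ (Alg n δ) :=
  Submodule.span ℂ (Alg.diag δ '' {b | f ≤ upperArcs b})

theorem mul_mem_arcSpan {δ : ℂ} {f : ℕ} (x y : Alg n δ)
    (h : x ∈ arcSpan n δ f ∨ y ∈ arcSpan n δ f) : x * y ∈ arcSpan n δ f := by
  have htop : ∀ z : Alg n δ, z ∈ Submodule.span ℂ (Alg.diag δ '' Set.univ) := by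
    intro z
    rw [Set.image_univ]
    exact (Alg.basis n δ).mem_span z
  have main : ∀ S T : Set (Diagram n), (∀ a ∈ S, ∀ b ∈ T, f ≤ upperArcs (comp a b)) →
      ∀ x ∈ Submodule.span ℂ (Alg.diag δ '' S), ∀ y ∈ Submodule.span ℂ (Alg.diag δ '' T),
        x * y ∈ arcSpan n δ f := by
    intro S T hST x hx y hy
    induction hx using Submodule.span_induction with
    | mem x hx =>
      obtain ⟨a, ha, rfl⟩ := hx
      induction hy using Submodule.span_induction with
      | mem y hy =>
        obtain ⟨b, hb, rfl⟩ := hy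
        rw [Alg.diag_mul_diag]
        exact Submodule.smul_mem _ _ (Submodule.subset_span ⟨_, hST a ha b hb, rfl⟩)
      | zero => rw [mul_zero]; exact Submodule.zero_mem _
      | add y z _ _ h1 h2 => rw [mul_add]; exact Submodule.add_mem _ h1 h2
      | smul r y _ h1 => rw [mul_smul_comm]; exact Submodule.smul_mem _ _ h1
    | zero => rw [zero_mul]; exact Submodule.zero_mem _
    | add x z _ _ h1 h2 => rw [add_mul]; exact Submodule.add_mem _ h1 h2
    | smul r x _ h1 => rw [smul_mul_assoc]; exact Submodule.smul_mem _ _ h1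
  rcases h with h | h
  · refine main _ _ (fun a ha b _ => ?_) x h y (htop y)
    rw [upperArcs_eq_lowerArcs]
    refine le_trans ?_ (lowerArcs_le_comp a b)
    rw [← upperArcs_eq_lowerArcs]
    exact ha
  · exact main _ _ (fun a _ b hb => le_trans hb (upperArcs_le_comp a b)) x (htop x) y h

/-- The two-sided ideal `J^(f)`: its elements form the span of all diagrams with at least `f`
arcs. -/
noncomputable def arcIdeal (n : ℕ) (δ : ℂ) (f : ℕ) : TwoSidedIdeal (Alg n δ) :=
  TwoSidedIdeal.mk' (arcSpan n δ f : Set (Alg n δ)) (Submodule.zero_mem _)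
    (fun hx hy => Submodule.add_mem _ hx hy) (fun hx => Submodule.neg_mem _ hx)
    (fun hy => mul_mem_arcSpan _ _ (Or.inr hy)) (fun hx => mul_mem_arcSpan _ _ (Or.inl hx))

theorem mem_arcIdeal {δ : ℂ} {f : ℕ} (x : Alg n δ) :
    x ∈ arcIdeal n δ f ↔ x ∈ arcSpan n δ f := by
  simp [arcIdeal]

end Arcs

/-- The subspace `ℂS_n` of `B_n(δ)`, spanned by the permutation diagrams. -/
noncomputable def symAlg (n : ℕ) (δ : ℂ) : Submodule ℂ (Alg n δ) :=
  Submodule.span ℂ (Set.range fun s : Equiv.Perm (Fin n) => Alg.diag δ (perm s))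

/-- The algebra `C_n(δ)`: the centraliser of `ℂS_n` in `B_n(δ)`. -/
noncomputable def centAlg (n : ℕ) (δ : ℂ) : Subalgebra ℂ (Alg n δ) :=
  Subalgebra.centralizer ℂ (symAlg n δ : Set (Alg n δ))

/-- The two-sided ideal `C_n(δ) ∩ J^(f)` of `C_n(δ)`. -/
noncomputable def centIdeal (n : ℕ) (δ : ℂ) (f : ℕ) : TwoSidedIdeal (centAlg n δ) :=
  (arcIdeal n δ f).comap (centAlg n δ).val

/-- The quotient algebra `C_n(δ) / J^(f)`, that is, the quotient of `C_n(δ)` by its ideal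
`C_n(δ) ∩ J^(f)`. -/
abbrev CentQuotient (n : ℕ) (δ : ℂ) (f : ℕ) : Type := (centIdeal n δ f).ringCon.Quotient

/-- The (in general non-unital) subalgebra `C_n(δ) ∩ J^(f)` of `B_n(δ)`. -/
noncomputable def centInter (n : ℕ) (δ : ℂ) (f : ℕ) : NonUnitalSubalgebra ℂ (Alg n δ) where
  carrier := {x | x ∈ centAlg n δ ∧ x ∈ arcIdeal n δ f}
  add_mem' hx hy := ⟨add_mem hx.1 hy.1, add_mem hx.2 hy.2⟩
  zero_mem' := ⟨zero_mem _, zero_mem _⟩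
  mul_mem' hx hy := ⟨mul_mem hx.1 hy.1, (arcIdeal n δ f).mul_mem_left _ _ hy.2⟩
  smul_mem' r x hx := ⟨Subalgebra.smul_mem _ hx.1 r, by
    rw [mem_arcIdeal]
    exact Submodule.smul_mem _ r ((mem_arcIdeal x).1 hx.2)⟩

end Brauer

/-! Commutativity. Turning diagrams upside down extends to a linear anti-automorphism `*` of
`B_n(δ)`, and an element centralises the symmetric group exactly when its coefficients are constant
on the orbits of simultaneous relabelling of both rows. If all diagrams occurring in `x`, `y` and `x
y` are conjugate to their reflections, then `*` fixes these three elements of the centraliser and `x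
y = (x y)* = y* x* = y x`. Diagrams with at most one arc per row, or with at most one through line,
are conjugate to their reflections. This gives commutativity modulo `J^(2)`, on `J^(⌊n/2⌋)`, and
everywhere for `n ≤ 5`, where two arcs leave at most one through line.

To conjugate `b` into its reflection it suffices to find a bijection of the `2n` nodes that commutes
with the line involution of `b` and with the exchange of rows, and moves each node to the other row.
These two involutions generate a dihedral group whose reflections have no fixed points. On each
orbit the bijection is `h x ↦ h (g x)` for a base point `x` and a reflection `g`. It changes rows
everywhere as soon as `x` and `g x` lie in different rows and the pattern of through lines seen from
`x` agrees with that seen from `g x`.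

Non-commutativity. For `2 ≤ f` and `2 f + 2 ≤ n` there are two elements of `C_n(δ) ∩ J^(f)` whose
commutator is not in `J^(f+1)` (`exists_commutator`); `f = 2` and `f = ⌊n/2⌋ - 1` yield all the
negative claims. One element sums the diagrams with `f` arcs whose upper and lower arcs coincide;
the other sums diagrams with `f` arcs whose upper and lower arcs merely have the same set of ends.
Some diagram `d` with `f` arcs has an upper arc `{u, v}` while its lower nodes `u`, `v` lie on
through lines. Such a `d` never arises in one order of multiplication. In the other order its
coefficient is a sum of powers of `δ` that cannot cancel: for `δ ≠ 0` a condition on common arcs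
makes all loop numbers equal, and for `δ = 0` each power is `0` or `1`, with a loop-free pair
contributing `1`. -/

namespace Brauer

variable {n : ℕ}

/-! ### Turning diagrams upside down and relabelling their nodes -/

/-- The diagram turned upside down. -/
def flip (b : Diagram n) : Diagram n where
  line v := (b.line v.swap).swap
  line_line v := by simp [b.line_line]
  line_ne v h := b.line_ne v.swap (by simpa using congrArg Sum.swap h)

theorem flip_flip (b : Diagram n) : flip (flip b) = b := by
  ext1; funext v; simp [flip]

/-- The node `i` of either row moved to the node `s i` of the same row. -/
def moveNode (s : Equiv.Perm (Fin n)) : Equiv.Perm (Fin n ⊕ Fin n) := Equiv.sumCongr s s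

/-- The diagram with the nodes of both rows relabelled by the same permutation. -/
def conj (s : Equiv.Perm (Fin n)) (b : Diagram n) : Diagram n where
  line v := moveNode s (b.line ((moveNode s).symm v))
  line_line v := by simp [b.line_line]
  line_ne v h := b.line_ne ((moveNode s).symm v) ((Equiv.eq_symm_apply _).2 h)

theorem conj_line_moveNode (s : Equiv.Perm (Fin n)) (b : Diagram n) (v) :
    (conj s b).line (moveNode s v) = moveNode s (b.line v) := by
  simp [conj]

theorem conj_conj (s t : Equiv.Perm (Fin n)) (b : Diagram n) :
    conj s (conj t b) = conj (s * t) b := by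
  ext1; funext v
  rcases v with i | i <;> simp only [conj, moveNode] <;>
  simp [Equiv.Perm.mul_def, ← Equiv.sumCongr_trans]

theorem conj_one (b : Diagram n) : conj 1 b = b := by
  ext1; funext v
  rcases v with i | i <;> simp only [conj, moveNode] <;> simp [Equiv.Perm.one_def]

/-- Relabelling as a permutation of the set of diagrams. -/
def conjEquiv (s : Equiv.Perm (Fin n)) : Equiv.Perm (Diagram n) where
  toFun := conj s
  invFun := conj s⁻¹
  left_inv b := by rw [conj_conj, inv_mul_cancel, conj_one]
  right_inv b := by rw [conj_conj, mul_inv_cancel, conj_one]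

/-- Turning upside down as a permutation of the set of diagrams. -/
def flipEquiv (n : ℕ) : Equiv.Perm (Diagram n) := ⟨flip, flip, flip_flip, flip_flip⟩

/-! ### Reflection and conjugation through colour matrices -/

theorem colMat_flip {κ : Type} (b : Diagram n) : colMat κ (flip b) = (colMat κ b).transpose := by
  classical
  ext x y
  have h : ∀ v : Fin n ⊕ Fin n, Sum.elim x y v.swap = Sum.elim y x v := by
    rintro (i | i) <;> rfl
  rw [Matrix.transpose_apply]
  unfold colMat
  congr 1
  refine propext ⟨fun H v => ?_, fun H v => ?_⟩
  · have := H v.swap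
    simp only [flip, Sum.swap_swap, h] at this
    exact this
  · have := H v.swap
    rw [← h, ← h, Sum.swap_swap] at this
    exact this

/-- The faithful colour matrices turn this into the rule for the transpose of a product. -/
theorem flip_comp (a b : Diagram n) :
    loops (flip b) (flip a) = loops a b ∧ comp (flip b) (flip a) = flip (comp a b) := by
  apply eq_of_smul_colMat
  have h := congrArg Matrix.transpose (colMat_mul (κ := Bool) a b)
  rw [Matrix.transpose_mul, ← colMat_flip, ← colMat_flip, colMat_mul, Matrix.transpose_smul,
    ← colMat_flip, Fintype.card_bool] at h
  exact h

theorem colMat_perm {κ : Type} [DecidableEq κ] (s : Equiv.Perm (Fin n)) (x y : Fin n → κ) :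
    colMat κ (perm s) x y = if x = y ∘ s then 1 else 0 := by
  classical
  unfold colMat
  congr 1
  refine propext ⟨fun H => ?_, ?_⟩
  · funext i; exact (H (.inl i)).symm
  · rintro rfl (i | i) <;> simp [perm]

theorem colMat_conj {κ : Type} (s : Equiv.Perm (Fin n)) (b : Diagram n) (x y : Fin n → κ) :
    colMat κ (conj s b) x y = colMat κ b (x ∘ s) (y ∘ s) := by
  classical
  have h : ∀ v : Fin n ⊕ Fin n, Sum.elim x y (moveNode s v) = Sum.elim (x ∘ s) (y ∘ s) v := by
    rintro (i | i) <;> rfl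
  unfold colMat
  congr 1
  refine propext ⟨fun H v => ?_, fun H v => ?_⟩
  · have := H (moveNode s v)
    rwa [conj_line_moveNode, h, h] at this
  · obtain ⟨v, rfl⟩ := (moveNode s).surjective v
    rw [conj_line_moveNode, h, h]
    exact H v

/-- This identifies relabelling with conjugation by the permutation diagram. The colour matrix of
`perm s` is a permutation matrix, so each sum over middle colourings has a single nonzero term. -/
theorem perm_comp (s : Equiv.Perm (Fin n)) (b : Diagram n) :
    loops (perm s) b = loops (conj s b) (perm s) ∧
      comp (perm s) b = comp (conj s b) (perm s) := by
  classical
  apply eq_of_smul_colMat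
  have h1 := colMat_mul (κ := Bool) (perm s) b
  have h2 := colMat_mul (κ := Bool) (conj s b) (perm s)
  rw [Fintype.card_bool] at h1 h2
  rw [← h1, ← h2]
  ext x y
  rw [Matrix.mul_apply, Matrix.mul_apply, Finset.sum_eq_single (y ∘ s),
    Finset.sum_eq_single (x ∘ s.symm)]
  · rw [colMat_perm, colMat_perm, colMat_conj, if_pos rfl, if_pos, mul_one, one_mul]
    · congr 1; funext i; simp
    · funext i; simp
  · intro m _ hm
    rw [colMat_perm, if_neg, zero_mul]
    rintro rfl
    exact hm (by funext i; simp)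
  · simp
  · intro m _ hm
    rw [colMat_perm, if_neg hm, mul_zero]
  · simp

theorem perm_comp_perm (s t : Equiv.Perm (Fin n)) :
    loops (perm s) (perm t) = 0 ∧ comp (perm s) (perm t) = perm (s * t) := by
  classical
  apply eq_of_smul_colMat
  have h1 := colMat_mul (κ := Bool) (perm s) (perm t)
  rw [Fintype.card_bool] at h1
  rw [← h1, pow_zero, one_smul]
  ext x y
  rw [Matrix.mul_apply, Finset.sum_eq_single (y ∘ s)]
  · rw [colMat_perm, colMat_perm, colMat_perm, if_pos rfl, mul_one]
    rfl
  · intro m _ hm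
    rw [colMat_perm (s := s), if_neg hm, mul_zero]
  · simp

instance : Finite (Diagram n) :=
  Finite.of_injective Diagram.line fun _ _ => Diagram.ext

noncomputable instance : Fintype (Diagram n) := Fintype.ofFinite _

/-! ### Coefficients -/

variable {δ : ℂ}

/-- The coefficient of a diagram in an element of the Brauer algebra. -/
noncomputable def coeff (b : Diagram n) : Alg n δ →ₗ[ℂ] ℂ := (Alg.basis n δ).coord b

theorem coeff_diag [DecidableEq (Diagram n)] (a b : Diagram n) :
    coeff b (Alg.diag δ a) = if a = b then 1 else 0 := by
  rw [coeff, Module.Basis.coord_apply, ← Alg.basis_apply, Module.Basis.repr_self,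
    Finsupp.single_apply]

theorem ext_coeff {x y : Alg n δ} (h : ∀ b, coeff b x = coeff b y) : x = y :=
  (Alg.basis n δ).ext_elem h

theorem sum_coeff (x : Alg n δ) : ∑ b, coeff b x • Alg.diag δ b = x :=
  (Alg.basis n δ).sum_repr x

theorem mem_arcSpan_iff {f : ℕ} (x : Alg n δ) :
    x ∈ arcSpan n δ f ↔ ∀ b, upperArcs b < f → coeff b x = 0 := by
  classical
  constructor
  · intro h b hb
    induction h using Submodule.span_induction with
    | mem x hx =>
      obtain ⟨a, ha, rfl⟩ := hx
      rw [coeff_diag, if_neg]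
      rintro rfl
      exact absurd hb (not_lt.2 ha)
    | zero => exact map_zero _
    | add x y _ _ h1 h2 => rw [map_add, h1, h2, add_zero]
    | smul r x _ h1 => rw [map_smul, h1, smul_zero]
  · intro h
    rw [← sum_coeff x]
    refine Submodule.sum_mem _ fun b _ => ?_
    by_cases hb : upperArcs b < f
    · rw [h b hb, zero_smul]; exact Submodule.zero_mem _
    · exact Submodule.smul_mem _ _ (Submodule.subset_span ⟨b, not_lt.1 hb, rfl⟩)

theorem arcSpan_antitone {f g : ℕ} (h : f ≤ g) : arcSpan n δ g ≤ arcSpan n δ f := fun x hx =>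
  (mem_arcSpan_iff x).2 fun b hb => (mem_arcSpan_iff x).1 hx b (hb.trans_le h)

/-- The linear map induced by a permutation of the diagrams. -/
noncomputable def permLin (δ : ℂ) (e : Equiv.Perm (Diagram n)) : Alg n δ →ₗ[ℂ] Alg n δ :=
  (Alg.basis n δ).constr ℂ fun b => Alg.diag δ (e b)

theorem permLin_diag (e : Equiv.Perm (Diagram n)) (b : Diagram n) :
    permLin δ e (Alg.diag δ b) = Alg.diag δ (e b) := by
  rw [← Alg.basis_apply, permLin, Module.Basis.constr_basis]

theorem coeff_permLin (e : Equiv.Perm (Diagram n)) (b : Diagram n) (x : Alg n δ) :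
    coeff (e b) (permLin δ e x) = coeff b x := by
  classical
  have : (coeff (e b)).comp (permLin δ e) = coeff (δ := δ) b :=
    (Alg.basis n δ).ext fun a => by
      rw [LinearMap.comp_apply, Alg.basis_apply, permLin_diag, coeff_diag, coeff_diag]
      simp
  exact LinearMap.congr_fun this x

/-- The anti-automorphism behind all the commutativity statements. -/
theorem permLin_flip_mul (x y : Alg n δ) :
    permLin δ (flipEquiv n) (x * y) = permLin δ (flipEquiv n) y * permLin δ (flipEquiv n) x := by
  conv_lhs => rw [← sum_coeff x, ← sum_coeff y]
  conv_rhs => rw [← sum_coeff x, ← sum_coeff y]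
  simp only [map_sum, Finset.sum_mul_sum, smul_mul_smul_comm, map_smul, permLin_diag,
    Alg.diag_mul_diag]
  rw [Finset.sum_comm]
  refine Finset.sum_congr rfl fun b _ => Finset.sum_congr rfl fun a _ => ?_
  change _ = _ • δ ^ loops (flip b) (flip a) • Alg.diag δ (comp (flip b) (flip a))
  rw [(flip_comp a b).1, (flip_comp a b).2, mul_comm]
  rfl

theorem diag_perm_mul (s : Equiv.Perm (Fin n)) (x : Alg n δ) :
    Alg.diag δ (perm s) * x = permLin δ (conjEquiv s) x * Alg.diag δ (perm s) := by
  conv_lhs => rw [← sum_coeff x]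
  conv_rhs => rw [← sum_coeff x]
  simp only [map_sum, map_smul, permLin_diag, Finset.mul_sum, Finset.sum_mul, mul_smul_comm,
    smul_mul_assoc, Alg.diag_mul_diag]
  refine Finset.sum_congr rfl fun b _ => ?_
  rw [(perm_comp s b).1, (perm_comp s b).2]
  rfl

/-- Permutation diagrams are invertible, so commuting with them means being fixed by conjugation,
which permutes the basis of diagrams. -/
theorem mem_centAlg_iff (x : Alg n δ) :
    x ∈ centAlg n δ ↔ ∀ s b, coeff (conj s b) x = coeff b x := by
  have h1 : x ∈ centAlg n δ ↔ ∀ s : Equiv.Perm (Fin n),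
      Alg.diag δ (perm s) * x = x * Alg.diag δ (perm s) := by
    rw [centAlg, Subalgebra.mem_centralizer_iff]
    constructor
    · intro h s
      exact h _ (Submodule.subset_span ⟨s, rfl⟩)
    · intro h z hz
      change z ∈ symAlg n δ at hz
      induction hz using Submodule.span_induction with
      | mem z hz => obtain ⟨s, rfl⟩ := hz; exact h s
      | zero => rw [zero_mul, mul_zero]
      | add y z _ _ h1 h2 => rw [add_mul, mul_add, h1, h2]
      | smul r z _ h1 => rw [smul_mul_assoc, mul_smul_comm, h1]
  rw [h1]
  constructor
  · intro h s b
    have h2 := h s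
    rw [diag_perm_mul] at h2
    have h3 := congrArg (· * Alg.diag δ (perm s⁻¹)) h2
    simp only [mul_assoc, Alg.diag_mul_diag, (perm_comp_perm s s⁻¹).1, (perm_comp_perm s s⁻¹).2,
      mul_inv_cancel, pow_zero, one_smul, ← Alg.one_def, mul_one] at h3
    rw [← coeff_permLin (conjEquiv s) b x, h3]
    rfl
  · intro h s
    rw [diag_perm_mul]
    congr 1
    refine ext_coeff fun b => ?_
    obtain ⟨b, rfl⟩ := (conjEquiv s).surjective b
    rw [coeff_permLin]
    exact (h s b).symm

theorem coeff_permLin_flip (b : Diagram n) (x : Alg n δ) :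
    coeff b (permLin δ (flipEquiv n) x) = coeff (flip b) x := by
  have := coeff_permLin (flipEquiv n) (flip b) x
  rwa [show flipEquiv n (flip b) = b from flip_flip b] at this

/-! ### Automorphisms of a set with two involutions -/

section Reflections

variable {V : Type*}

/-- On each orbit take a base point `x = a v` and set `φ (h x) = h (g x)`. The stabiliser condition
makes this well defined, and equivariance is built in. -/
theorem exists_equivariant [Finite V] (G : Subgroup (Equiv.Perm V)) (P : V → V → Prop)
    (H : ∀ v, ∃ a ∈ G, ∃ g ∈ G, (∀ h ∈ G, h (a v) = a v → h (g (a v)) = g (a v)) ∧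
      ∀ h ∈ G, P (h (a v)) (h (g (a v)))) :
    ∃ φ : V → V, Function.Bijective φ ∧ (∀ h ∈ G, ∀ v, φ (h v) = h (φ v)) ∧ ∀ v, P v (φ v) := by
  choose a ha g hg hfix hP using H
  -- `r v` is a representative of the orbit of `v`; the base point of that orbit is `a (r v) (r v)`.
  let r : V → V := fun v => (Quotient.mk (MulAction.orbitRel G V) v).out
  have hr : ∀ h ∈ G, ∀ v, r (h v) = r v := fun h hh v =>
    congrArg Quotient.out (Quotient.sound (s := MulAction.orbitRel G V) ⟨⟨h, hh⟩, rfl⟩)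
  have hr' : ∀ v, ∃ k ∈ G, k (r v) = v := by
    intro v
    obtain ⟨k, hk⟩ := (MulAction.orbitRel G V).symm (Quotient.mk_out (s := MulAction.orbitRel G V) v)
    exact ⟨k, k.2, hk⟩
  have hx : ∀ v, ∃ k ∈ G, k (a (r v) (r v)) = v := by
    intro v
    obtain ⟨k, hk, e⟩ := hr' v
    exact ⟨k * (a (r v))⁻¹, G.mul_mem hk (G.inv_mem (ha _)), by simp [e]⟩
  choose k hk hkv using hx
  let φ : V → V := fun v => k v (g (r v) (a (r v) (r v)))
  -- The value of `φ` does not depend on which group element carries the base point to `v`.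
  have key : ∀ v, ∀ h ∈ G, h (a (r v) (r v)) = v → φ v = h (g (r v) (a (r v) (r v))) := by
    intro v h hh e
    have h1 : (h⁻¹ * k v) (a (r v) (r v)) = a (r v) (r v) := by
      rw [Equiv.Perm.mul_apply, hkv, Equiv.Perm.inv_eq_iff_eq, e]
    have h2 := hfix (r v) _ (G.mul_mem (G.inv_mem hh) (hk v)) h1
    rwa [Equiv.Perm.mul_apply, Equiv.Perm.inv_eq_iff_eq] at h2
  refine ⟨φ, Function.Surjective.bijective_of_finite ?_, ?_, ?_⟩
  · intro w
    obtain ⟨c, hc, e⟩ := hr' w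
    -- `m` carries the image of the base point under `g` to `w`, so `m` applied to the base point is
    -- a preimage of `w`.
    let m := c * (a (r w))⁻¹ * (g (r w))⁻¹
    have hm : m ∈ G := G.mul_mem (G.mul_mem hc (G.inv_mem (ha _))) (G.inv_mem (hg _))
    have hrm : r ((m * a (r w)) (r w)) = r w := by
      rw [hr _ (G.mul_mem hm (ha _))]
      have := hr c hc (r w)
      rw [e] at this
      exact this.symm
    refine ⟨(m * a (r w)) (r w), ?_⟩
    rw [key _ m hm (by rw [hrm]; rfl), hrm]
    simp [m, e]
  · intro h hh v
    rw [key (h v) (h * k v) (G.mul_mem hh (hk v)) (by rw [hr h hh, Equiv.Perm.mul_apply, hkv]),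
      hr h hh]
    rfl
  · intro v
    have := hP (r v) (k v) (hk v)
    rwa [hkv] at this

variable (σ τ : Equiv.Perm V) (hσ : ∀ x, σ (σ x) = x) (hτ : ∀ x, τ (τ x) = x)

include hσ hτ

theorem mul_zpow_of_involutive (k : ℤ) : τ * (σ * τ) ^ k = (σ * τ) ^ (-k) * τ := by
  have hσ2 : σ⁻¹ = σ := by ext y; rw [Equiv.Perm.inv_eq_iff_eq, hσ]
  have hτ2 : τ⁻¹ = τ := by ext y; rw [Equiv.Perm.inv_eq_iff_eq, hτ]
  have h1 : τ * (σ * τ) ^ k * τ⁻¹ = (σ * τ) ^ (-k) := by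
    rw [← conj_zpow, zpow_neg, ← inv_zpow]
    congr 1
    rw [mul_inv_rev, hσ2, hτ2]
    ext y; simp [hτ]
  rw [← h1, inv_mul_cancel_right]

theorem reflection_sq (k : ℤ) : ((σ * τ) ^ k * τ) * ((σ * τ) ^ k * τ) = 1 := by
  rw [mul_assoc, ← mul_assoc τ, mul_zpow_of_involutive σ τ hσ hτ, mul_assoc, ← mul_assoc,
    ← zpow_add, add_neg_cancel, zpow_zero, one_mul]
  ext y; simp [hτ]

/-- The dihedral normal form: every word in the two involutions is a rotation or a reflection. -/
theorem mem_closure_involutions {h : Equiv.Perm V} (hh : h ∈ Subgroup.closure {σ, τ}) :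
    ∃ k : ℤ, h = (σ * τ) ^ k ∨ h = (σ * τ) ^ k * τ := by
  have hτ1 : τ * τ = 1 := by ext y; simp [hτ]
  have hσ2 : σ⁻¹ = σ := by ext y; rw [Equiv.Perm.inv_eq_iff_eq, hσ]
  have hτ2 : τ⁻¹ = τ := by ext y; rw [Equiv.Perm.inv_eq_iff_eq, hτ]
  have step : ∀ z ∈ ({σ, τ} : Set (Equiv.Perm V)), ∀ y : Equiv.Perm V,
      (∃ k : ℤ, y = (σ * τ) ^ k ∨ y = (σ * τ) ^ k * τ) →
      ∃ k : ℤ, z * y = (σ * τ) ^ k ∨ z * y = (σ * τ) ^ k * τ := by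
    have tau : ∀ y : Equiv.Perm V, (∃ k : ℤ, y = (σ * τ) ^ k ∨ y = (σ * τ) ^ k * τ) →
        ∃ k : ℤ, τ * y = (σ * τ) ^ k ∨ τ * y = (σ * τ) ^ k * τ := by
      rintro y ⟨k, rfl | rfl⟩
      · exact ⟨-k, Or.inr (mul_zpow_of_involutive σ τ hσ hτ k)⟩
      · refine ⟨-k, Or.inl ?_⟩
        rw [← mul_assoc, mul_zpow_of_involutive σ τ hσ hτ k, mul_assoc, hτ1, mul_one]
    rintro z (rfl | rfl) y hy
    · have e : z * y = z * τ * (τ * y) := by rw [mul_assoc, ← mul_assoc τ τ, hτ1, one_mul]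
      obtain ⟨k, hk | hk⟩ := tau y hy
      · exact ⟨1 + k, Or.inl (by rw [zpow_one_add, ← hk, e])⟩
      · exact ⟨1 + k, Or.inr (by rw [zpow_one_add, mul_assoc (z * τ), ← hk, e])⟩
    · exact tau y hy
  induction hh using Subgroup.closure_induction_left with
  | one => exact ⟨0, Or.inl rfl⟩
  | mul_left x hx y _ ih => exact step x hx y ih
  | inv_mul_cancel x hx y _ ih =>
    have : x⁻¹ = x := by rcases hx with rfl | rfl <;> assumption
    rw [this]
    exact step x hx y ih

variable (hσ' : ∀ x, σ x ≠ x) (hτ' : ∀ x, τ x ≠ x)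

include hσ' hτ'

theorem reflection_ne (k : ℤ) (x : V) : ((σ * τ) ^ k * τ) x ≠ x := by
  have hτ1 : τ * τ = 1 := by ext y; simp [hτ]
  have conjugate : ∀ (j : ℤ) (κ : Equiv.Perm V), (∀ y, κ y ≠ y) →
      ((σ * τ) ^ j * κ * (σ * τ) ^ (-j)) x ≠ x := by
    intro j κ hκ h
    apply hκ (((σ * τ) ^ (-j)) x)
    rw [Equiv.Perm.mul_apply, Equiv.Perm.mul_apply] at h
    rw [zpow_neg] at h ⊢
    rw [Equiv.Perm.eq_inv_iff_eq]
    exact h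
  -- According to the parity of `k`, the reflection is conjugate to `τ` or to `σ`, neither of which
  -- has a fixed point.
  rcases Int.even_or_odd' k with ⟨j, rfl | rfl⟩
  · have : (σ * τ) ^ (2 * j) * τ = (σ * τ) ^ j * τ * (σ * τ) ^ (-j) := by
      rw [mul_assoc _ τ, mul_zpow_of_involutive σ τ hσ hτ, ← mul_assoc, ← zpow_add]
      congr 2
      ring
    rw [this]
    exact conjugate j τ hτ'
  · have : (σ * τ) ^ (2 * j + 1) * τ = (σ * τ) ^ j * σ * (σ * τ) ^ (-j) := by
      have e : σ * (σ * τ) ^ (-j) = σ * τ * (τ * (σ * τ) ^ (-j)) := by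
        rw [mul_assoc σ τ, ← mul_assoc τ τ, hτ1, one_mul]
      rw [mul_assoc _ σ, e, mul_zpow_of_involutive σ τ hσ hτ, ← mul_assoc, ← mul_assoc,
        ← zpow_add_one, ← zpow_add]
      congr 2
      ring
    rw [this]
    exact conjugate j σ hσ'

/-- Since reflections have no fixed points, `h` is a rotation. Moving it past a reflection inverts
it, and its inverse fixes `x` as well. -/
theorem reflection_fixed {h : Equiv.Perm V} (hh : h ∈ Subgroup.closure {σ, τ}) (k : ℤ) {x : V}
    (hx : h x = x) : h (((σ * τ) ^ k * τ) x) = ((σ * τ) ^ k * τ) x := by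
  obtain ⟨m, rfl | rfl⟩ := mem_closure_involutions σ τ hσ hτ hh
  · have hx' : ((σ * τ) ^ (-m)) x = x := by
      rw [zpow_neg, Equiv.Perm.inv_eq_iff_eq, hx]
    have e := mul_zpow_of_involutive σ τ hσ hτ (-m)
    rw [neg_neg] at e
    rw [← Equiv.Perm.mul_apply, ← mul_assoc, ← zpow_add, add_comm, zpow_add, mul_assoc, ← e,
      ← mul_assoc, Equiv.Perm.mul_apply, hx']
  · exact absurd hx (reflection_ne σ τ hσ hτ hσ' hτ' m x)

end Reflections

/-! ### Diagrams that are conjugate to their reflection -/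

/-- The lines of a diagram as a permutation of its nodes. -/
def linePerm (b : Diagram n) : Equiv.Perm (Fin n ⊕ Fin n) :=
  ⟨b.line, b.line, b.line_line, b.line_line⟩

/-- The exchange of the two rows. -/
def swapPerm (n : ℕ) : Equiv.Perm (Fin n ⊕ Fin n) := Equiv.sumComm _ _

/-- The line at a node joins the two rows. -/
def Through (b : Diagram n) (v : Fin n ⊕ Fin n) : Prop := (b.line v).isLeft ≠ v.isLeft

theorem swapPerm_isLeft (v : Fin n ⊕ Fin n) : (swapPerm n v).isLeft = !v.isLeft := by
  cases v <;> rfl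

theorem swapPerm_swapPerm (v : Fin n ⊕ Fin n) : swapPerm n (swapPerm n v) = v := by
  cases v <;> rfl

theorem swapPerm_ne (v : Fin n ⊕ Fin n) : swapPerm n v ≠ v := by
  cases v <;> simp [swapPerm]

theorem through_line (b : Diagram n) (v) : Through b (b.line v) ↔ Through b v := by
  unfold Through
  rw [b.line_line, ne_comm]

/-- The group generated by the lines of a diagram and the exchange of the rows. -/
def lineGroup (b : Diagram n) : Subgroup (Equiv.Perm (Fin n ⊕ Fin n)) :=
  Subgroup.closure {linePerm b, swapPerm n}

theorem linePerm_mem (b : Diagram n) : linePerm b ∈ lineGroup b :=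
  Subgroup.subset_closure (Or.inl rfl)

theorem swapPerm_mem (b : Diagram n) : swapPerm n ∈ lineGroup b :=
  Subgroup.subset_closure (Or.inr rfl)

/-- Induction on words: exchanging the rows moves both nodes to the other row, and applying the
lines of `b` moves both or neither, since `Through` agrees at the two nodes. -/
theorem isLeft_ne_of_through (b : Diagram n) {x y : Fin n ⊕ Fin n} (hxy : x.isLeft ≠ y.isLeft)
    (hT : ∀ h ∈ lineGroup b, Through b (h x) ↔ Through b (h y)) :
    ∀ h ∈ lineGroup b, (h x).isLeft ≠ (h y).isLeft := by
  have step : ∀ z ∈ ({linePerm b, swapPerm n} : Set (Equiv.Perm (Fin n ⊕ Fin n))),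
      ∀ g ∈ lineGroup b, (g x).isLeft ≠ (g y).isLeft → ((z * g) x).isLeft ≠ ((z * g) y).isLeft := by
    rintro z (rfl | rfl) g hg ih
    · have := hT g hg
      simp only [Through] at this
      change (b.line (g x)).isLeft ≠ (b.line (g y)).isLeft
      revert this ih
      generalize (b.line (g x)).isLeft = p
      generalize (b.line (g y)).isLeft = q
      generalize (g x).isLeft = r
      generalize (g y).isLeft = s
      decide +revert
    · rw [Equiv.Perm.mul_apply, Equiv.Perm.mul_apply, swapPerm_isLeft, swapPerm_isLeft]
      exact fun e => ih (Bool.not_inj e)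
  intro h hh
  unfold lineGroup at hh
  induction hh using Subgroup.closure_induction_left with
  | one => exact hxy
  | mul_left z hz g hg ih => exact step z hz g hg ih
  | inv_mul_cancel z hz g hg ih =>
    have : z⁻¹ = z := by
      rcases hz with rfl | rfl
      · ext1 v; rw [Equiv.Perm.inv_eq_iff_eq]; exact (b.line_line v).symm
      · ext1 v; rw [Equiv.Perm.inv_eq_iff_eq, swapPerm_swapPerm]
    rw [this]
    exact step z hz g hg ih

/-- The reflection chosen on each orbit gives an equivariant bijection `φ` that changes rows.
Following `φ` by the row exchange gives a map that preserves rows and acts alike on both, that is, a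
relabelling `s`; equivariance under the lines of `b` then says that `s` carries `b` to its
reflection. -/
theorem exists_conj_eq_flip (b : Diagram n)
    (H : ∀ v, ∃ a ∈ lineGroup b, ∃ k : ℤ,
      (a v).isLeft ≠ (((linePerm b * swapPerm n) ^ k * swapPerm n) (a v)).isLeft ∧
      ∀ h ∈ lineGroup b, Through b (h (a v)) ↔
        Through b (h (((linePerm b * swapPerm n) ^ k * swapPerm n) (a v)))) :
    ∃ s, conj s b = flip b := by
  obtain ⟨φ, hbij, hφ, hP⟩ := exists_equivariant (lineGroup b)
    (fun v w => v.isLeft ≠ w.isLeft) (fun v => by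
      obtain ⟨a, ha, k, h1, h2⟩ := H v
      refine ⟨a, ha, _, (lineGroup b).mul_mem ((lineGroup b).zpow_mem ((lineGroup b).mul_mem
        (linePerm_mem b) (swapPerm_mem b)) k) (swapPerm_mem b), fun h hh hx => ?_,
        isLeft_ne_of_through b h1 h2⟩
      exact reflection_fixed (linePerm b) (swapPerm n) b.line_line swapPerm_swapPerm b.line_ne
        swapPerm_ne hh k hx)
  have hs : ∀ i : Fin n, ∃ j, φ (.inl i) = .inr j := by
    intro i
    have := hP (.inl i)
    revert this
    rcases φ (.inl i) with j | j <;> simp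
  choose s hs using hs
  have hs' : ∀ i, φ (.inr i) = .inl (s i) := by
    intro i
    have := hφ _ (swapPerm_mem b) (.inl i)
    rw [hs] at this
    exact this
  have hinj : Function.Injective s := fun i j e => by
    have : φ (.inl i) = φ (.inl j) := by rw [hs, hs, e]
    exact Sum.inl_injective (hbij.1 this)
  refine ⟨Equiv.ofBijective s (Finite.injective_iff_bijective.1 hinj), ?_⟩
  have hm : ∀ v, moveNode (Equiv.ofBijective s (Finite.injective_iff_bijective.1 hinj)) v =
      (φ v).swap := by
    rintro (i | i)
    · rw [hs]; rfl
    · rw [hs']; rfl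
  ext1
  funext v
  obtain ⟨v, rfl⟩ :=
    (moveNode (Equiv.ofBijective s (Finite.injective_iff_bijective.1 hinj))).surjective v
  rw [conj_line_moveNode, hm, hm]
  simp only [flip, Sum.swap_swap]
  rw [show b.line v = linePerm b v from rfl, hφ _ (linePerm_mem b)]
  rfl

/-- `φ` stands for the inclusion of either row, so that both rows are treated at once. -/
theorem eq_or_eq_of_card_le_one {φ : Fin n → Fin n ⊕ Fin n} {b : Diagram n}
    (h : (Finset.univ.filter fun p : Fin n × Fin n =>
      p.1 < p.2 ∧ b.line (φ p.1) = φ p.2).card ≤ 1) {i j k l : Fin n}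
    (hi : b.line (φ i) = φ k) (hj : b.line (φ j) = φ l) : φ j = φ i ∨ φ j = φ k := by
  have lt : ∀ {i k}, b.line (φ i) = φ k → i ≠ k := by
    rintro i k h rfl
    exact b.line_ne _ h
  have symm : ∀ {i k}, b.line (φ i) = φ k → b.line (φ k) = φ i := by
    intro i k h
    rw [← h, b.line_line]
  rw [Finset.card_le_one] at h
  have h' : ∀ i j k l : Fin n, i < k → j < l → b.line (φ i) = φ k → b.line (φ j) = φ l →
      i = j ∧ k = l := by
    intro i j k l h1 h2 h3 h4
    have := h (i, k) (by simp [h1, h3]) (j, l) (by simp [h2, h4])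
    simpa using this
  rcases lt_or_gt_of_ne (lt hi) with h1 | h1 <;> rcases lt_or_gt_of_ne (lt hj) with h2 | h2
  · left; rw [(h' _ _ _ _ h1 h2 hi hj).1]
  · right; rw [(h' _ _ _ _ h1 h2 hi (symm hj)).2]
  · right; rw [(h' _ _ _ _ h1 h2 (symm hi) hj).1]
  · left; rw [(h' _ _ _ _ h1 h2 (symm hi) (symm hj)).2]

theorem eq_or_eq_line_of_not_through {b : Diagram n} (h : upperArcs b ≤ 1)
    {v w : Fin n ⊕ Fin n} (hv : ¬ Through b v) (hw : ¬ Through b w) (hvw : v.isLeft = w.isLeft) :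
    w = v ∨ w = b.line v := by
  have h' : lowerArcs b ≤ 1 := by rwa [← upperArcs_eq_lowerArcs]
  simp only [Through, not_not] at hv hw
  rcases v with i | i <;> rcases w with j | j <;> simp only [Sum.isLeft_inl, Sum.isLeft_inr,
    Sum.isLeft_iff, Sum.isLeft_eq_false, Sum.isRight_iff, reduceCtorEq] at hv hw hvw
  · obtain ⟨k, hk⟩ := hv
    obtain ⟨l, hl⟩ := hw
    rw [hk]
    exact eq_or_eq_of_card_le_one h hk hl
  · obtain ⟨k, hk⟩ := hv
    obtain ⟨l, hl⟩ := hw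
    rw [hk]
    exact eq_or_eq_of_card_le_one h' hk hl

/-- A diagram with at most one arc in either row is conjugate to its reflection. -/
theorem exists_conj_eq_flip_of_le_one (b : Diagram n) (hb : upperArcs b ≤ 1) :
    ∃ s, conj s b = flip b := by
  apply exists_conj_eq_flip
  intro v
  -- An orbit without arcs needs only the exchange of rows as its reflection. Otherwise the base
  -- point `x` is taken at the end of an arc.
  by_cases hv : ∀ a ∈ lineGroup b, Through b (a v)
  · refine ⟨1, one_mem _, 0, ?_, fun h hh => ?_⟩
    · rw [zpow_zero, one_mul]
      exact fun e => Bool.not_ne_self _ ((swapPerm_isLeft _).symm.trans e.symm)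
    · rw [zpow_zero, one_mul, ← Equiv.Perm.mul_apply, ← Equiv.Perm.mul_apply,
        ← Equiv.Perm.mul_apply]
      simp only [mul_one]
      exact iff_of_true (hv h hh) (hv _ ((lineGroup b).mul_mem hh (swapPerm_mem b)))
  · push Not at hv
    obtain ⟨a, ha, hx⟩ := hv
    refine ⟨a, ha, ?_⟩
    generalize a v = x at hx
    set ρ : Equiv.Perm (Fin n ⊕ Fin n) := linePerm b * swapPerm n with hρ
    have hLx : (b.line x).isLeft = x.isLeft := by simpa [Through] using hx
    -- One step of `ρ` exchanges the rows and then follows a line; if that line is a through line,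
    -- the walk is back in the row of `x`.
    have walk : ∀ k : ℕ, (∀ j < k, Through b (swapPerm n ((ρ ^ j) x))) →
        ((ρ ^ k) x).isLeft = x.isLeft := by
      intro k
      induction k with
      | zero => intro _; rfl
      | succ k ih =>
        intro h
        have h1 := ih fun j hj => h j (hj.trans k.lt_succ_self)
        have h2 := h k k.lt_succ_self
        rw [pow_succ', Equiv.Perm.mul_apply, ← h1, hρ, Equiv.Perm.mul_apply]
        rw [Through, swapPerm_isLeft] at h2
        change (b.line (swapPerm n ((ρ ^ k) x))).isLeft = _
        exact Bool.ne_not.1 h2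
    -- If the walk met only through lines, it would stay in the row of `x` until it closes up. But
    -- the step into `x` comes along its arc, from `b.line x`, which is in the row of `x` and yet is
    -- the row exchange of a node of the walk.
    have hex : ∃ k : ℕ, ¬ Through b (swapPerm n ((ρ ^ k) x)) := by
      by_contra! h
      have hall : ∀ k : ℕ, ((ρ ^ k) x).isLeft = x.isLeft := fun k => walk k fun j _ => h j
      have h1 := hall (orderOf ρ - 1)
      have h2 : ρ ((ρ ^ (orderOf ρ - 1)) x) = x := by
        rw [← Equiv.Perm.mul_apply, ← pow_succ', Nat.sub_add_cancel (orderOf_pos ρ),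
          pow_orderOf_eq_one]
        rfl
      have h3 : swapPerm n ((ρ ^ (orderOf ρ - 1)) x) = b.line x := by
        have := congrArg b.line h2
        rw [hρ, Equiv.Perm.mul_apply] at this
        rw [← this]
        exact (b.line_line _).symm
      have h4 := congrArg Sum.isLeft h3
      rw [swapPerm_isLeft, h1, hLx] at h4
      exact Bool.not_ne_self _ h4
    classical
    obtain ⟨k, hk, hmin⟩ : ∃ k : ℕ, ¬ Through b (swapPerm n ((ρ ^ k) x)) ∧
        ∀ j < k, Through b (swapPerm n ((ρ ^ j) x)) :=
      ⟨Nat.find hex, Nat.find_spec hex, fun j hj => not_not.1 (Nat.find_min hex hj)⟩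
    refine ⟨-(k : ℤ), ?_⟩
    -- This reflection sends `x` to the first arc end met by the walk, which lies in the opposite
    -- row.
    have hg : ρ ^ (-(k : ℤ)) * swapPerm n = swapPerm n * ρ ^ k := by
      rw [← zpow_natCast, hρ, mul_zpow_of_involutive (linePerm b) (swapPerm n) b.line_line
        swapPerm_swapPerm]
    set g := ρ ^ (-(k : ℤ)) * swapPerm n
    have hgG : g ∈ lineGroup b := (lineGroup b).mul_mem ((lineGroup b).zpow_mem
      ((lineGroup b).mul_mem (linePerm_mem b) (swapPerm_mem b)) _) (swapPerm_mem b)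
    have hgg : ∀ z, g (g z) = z := fun z => by
      have := reflection_sq (linePerm b) (swapPerm n) b.line_line swapPerm_swapPerm (-(k : ℤ))
      exact congrArg (fun f : Equiv.Perm _ => f z) this
    have hy : ¬ Through b (g x) := by rw [hg]; exact hk
    have hcol : x.isLeft ≠ (g x).isLeft := by
      rw [hg, Equiv.Perm.mul_apply, swapPerm_isLeft, walk k hmin]
      exact (Bool.not_ne_self _).symm
    have hfix : ∀ h ∈ lineGroup b, ∀ z, h z = z → h (g z) = g z := fun h hh z hz =>
      reflection_fixed (linePerm b) (swapPerm n) b.line_line swapPerm_swapPerm b.line_ne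
        swapPerm_ne hh _ hz
    -- With at most one arc per row, the arcs at `x` and at `g x` are all the arcs there are.
    have hset : ∀ z, ¬ Through b z ↔ z = x ∨ z = b.line x ∨ z = g x ∨ z = b.line (g x) := by
      intro z
      constructor
      · intro hz
        by_cases hc : x.isLeft = z.isLeft
        · rcases eq_or_eq_line_of_not_through hb hx hz hc with h | h <;> simp [h]
        · have : (g x).isLeft = z.isLeft := by
            revert hc hcol
            generalize x.isLeft = p
            generalize z.isLeft = q
            generalize (g x).isLeft = r
            decide +revert
          rcases eq_or_eq_line_of_not_through hb hy hz this with h | h <;> simp [h]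
      · rintro (rfl | rfl | rfl | rfl)
        · exact hx
        · rwa [through_line]
        · exact hy
        · rwa [through_line]
    -- If `h z` is one of the four arc ends `z`, `b.line z`, `g z`, `b.line (g z)`, then `h`
    -- followed by a suitable product of the lines and `g` fixes `z`. By `hfix` it also fixes `g z`,
    -- which locates `h (g z)` among the same four nodes.
    have key : ∀ h ∈ lineGroup b, ∀ z, (z = x ∨ z = g x) →
        ¬ Through b (h z) → ¬ Through b (h (g z)) := by
      intro h hh z hz hT
      have hz' : ∀ w, (w = x ∨ w = b.line x ∨ w = g x ∨ w = b.line (g x)) ↔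
          (w = z ∨ w = b.line z ∨ w = g z ∨ w = b.line (g z)) := by
        intro w
        rcases hz with rfl | rfl
        · exact Iff.rfl
        · rw [hgg]; tauto
      rw [hset, hz'] at hT ⊢
      have hL := linePerm_mem b
      rcases hT with h1 | h1 | h1 | h1
      · exact Or.inr (Or.inr (Or.inl (hfix h hh z h1)))
      · refine Or.inr (Or.inr (Or.inr ?_))
        have := hfix (linePerm b * h) ((lineGroup b).mul_mem hL hh) z (by
          rw [Equiv.Perm.mul_apply, h1]; exact b.line_line z)
        exact (b.line_line _).symm.trans (congrArg b.line this)
      · left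
        have := hfix (g * h) ((lineGroup b).mul_mem hgG hh) z (by
          rw [Equiv.Perm.mul_apply, h1, hgg])
        rw [Equiv.Perm.mul_apply] at this
        exact g.injective this
      · right; left
        have := hfix (g * (linePerm b * h)) ((lineGroup b).mul_mem hgG ((lineGroup b).mul_mem hL hh))
          z (by
            change g (b.line (h z)) = z
            rw [h1, b.line_line, hgg])
        rw [Equiv.Perm.mul_apply] at this
        have h2 : b.line (h (g z)) = z := g.injective this
        exact (b.line_line _).symm.trans (congrArg b.line h2)
    refine ⟨hcol, fun h hh => ?_⟩
    rw [← not_iff_not]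
    refine ⟨key h hh x (Or.inl rfl), fun h1 => ?_⟩
    have := key h hh (g x) (Or.inr rfl) h1
    rwa [hgg] at this

/-- At most one upper node is off the arcs, and every through line has an upper end. -/
theorem eq_or_eq_line_of_through {b : Diagram n} (h : n ≤ 2 * upperArcs b + 1)
    {v w : Fin n ⊕ Fin n} (hv : Through b v) (hw : Through b w) : w = v ∨ w = b.line v := by
  classical
  have hu : 2 * upperArcs b = _ := arcs_count Sum.inl Sum.inl_injective b
  have h1 := Finset.card_filter_add_card_filter_not (s := (Finset.univ : Finset (Fin n)))
    (fun i => ∃ j, b.line (.inl i) = .inl j)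
  have hc : (Finset.univ.filter fun i : Fin n => ¬ ∃ j, b.line (.inl i) = .inl j).card ≤ 1 := by
    rw [Finset.card_univ, Fintype.card_fin] at h1
    omega
  rw [Finset.card_le_one] at hc
  have up : ∀ {v}, Through b v → ∃ i : Fin n, (v = .inl i ∨ v = b.line (.inl i)) ∧
      ¬ ∃ j, b.line (.inl i) = .inl j := by
    intro v hv
    rcases v with i | i
    · refine ⟨i, Or.inl rfl, ?_⟩
      rintro ⟨j, hj⟩
      simp [Through, hj] at hv
    · have hl : (b.line (.inr i)).isLeft = true := by simpa [Through] using hv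
      obtain ⟨j, hj⟩ := Sum.isLeft_iff.1 hl
      have hj' : b.line (.inl j) = .inr i := by rw [← hj, b.line_line]
      exact ⟨j, Or.inr hj'.symm, by simp [hj']⟩
  obtain ⟨i, hi, hi'⟩ := up hv
  obtain ⟨j, hj, hj'⟩ := up hw
  have hij := hc i (by simpa using hi') j (by simpa using hj')
  subst hij
  rcases hi with rfl | rfl <;> rcases hj with rfl | rfl <;> simp [b.line_line]

/-- A diagram with at most one through line is conjugate to its reflection. -/
theorem exists_conj_eq_flip_of_le_two_mul (b : Diagram n) (hb : n ≤ 2 * upperArcs b + 1) :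
    ∃ s, conj s b = flip b := by
  apply exists_conj_eq_flip
  intro v
  by_cases hv : ∃ a ∈ lineGroup b, Through b (a v)
  · obtain ⟨a, ha, hx⟩ := hv
    -- On an orbit containing the through line, the line involution itself serves as the reflection:
    -- it exchanges the two ends of that line, which lie in different rows.
    have hg : (linePerm b * swapPerm n) ^ (1 : ℤ) * swapPerm n = linePerm b := by
      rw [zpow_one, mul_assoc, show swapPerm n * swapPerm n = 1 from
        Equiv.ext swapPerm_swapPerm, mul_one]
    refine ⟨a, ha, 1, ?_⟩
    have hfix := fun h (hh : h ∈ lineGroup b) z (hz : h z = z) =>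
      reflection_fixed (linePerm b) (swapPerm n) b.line_line swapPerm_swapPerm b.line_ne
        swapPerm_ne hh 1 hz
    rw [hg] at hfix ⊢
    generalize a v = x at hx
    have hfix' : ∀ h ∈ lineGroup b, ∀ z, h z = z → h (b.line z) = b.line z := hfix
    have hset : ∀ z, Through b z ↔ z = x ∨ z = b.line x := fun z =>
      ⟨fun hz => eq_or_eq_line_of_through hb hx hz, by
        rintro (rfl | rfl)
        · exact hx
        · rwa [through_line]⟩
    have key : ∀ h ∈ lineGroup b, ∀ z, (z = x ∨ z = b.line x) →
        Through b (h z) → Through b (h (b.line z)) := by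
      intro h hh z hz hT
      have hz' : ∀ w, (w = x ∨ w = b.line x) ↔ (w = z ∨ w = b.line z) := by
        intro w
        rcases hz with rfl | rfl
        · exact Iff.rfl
        · rw [b.line_line]; tauto
      rw [hset, hz'] at hT ⊢
      rcases hT with h1 | h1
      · exact Or.inr (hfix' h hh z h1)
      · left
        have := hfix' (linePerm b * h) ((lineGroup b).mul_mem (linePerm_mem b) hh) z (by
          rw [Equiv.Perm.mul_apply, h1]; exact b.line_line z)
        exact (linePerm b).injective this
    refine ⟨hx.symm, fun h hh => ⟨key h hh x (Or.inl rfl), fun h1 => ?_⟩⟩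
    have := key h hh (b.line x) (Or.inr rfl) h1
    rwa [b.line_line] at this
  · push Not at hv
    refine ⟨1, one_mem _, 0, ?_, fun h hh => ?_⟩
    · rw [zpow_zero, one_mul]
      exact fun e => Bool.not_ne_self _ ((swapPerm_isLeft _).symm.trans e.symm)
    · rw [zpow_zero, one_mul]
      exact iff_of_false (hv h hh) (hv _ ((lineGroup b).mul_mem hh (swapPerm_mem b)))

/-! ### Commutativity -/

theorem coeff_flip_of_mem_centAlg {x : Alg n δ} (hx : x ∈ centAlg n δ) (b : Diagram n)
    (hb : upperArcs b ≤ 1 ∨ n ≤ 2 * upperArcs b + 1) : coeff (flip b) x = coeff b x := by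
  obtain ⟨s, hs⟩ := hb.elim (exists_conj_eq_flip_of_le_one b) (exists_conj_eq_flip_of_le_two_mul b)
  rw [← hs]
  exact (mem_centAlg_iff x).1 hx s b

/-- Reflection fixes the centraliser modulo `J^(2)`, so modulo this ideal `x y` equals its
reflection, which is the product of the reflections in reverse order, hence `y x`. -/
theorem commutator_mem_arcSpan_two {x y : Alg n δ} (hx : x ∈ centAlg n δ) (hy : y ∈ centAlg n δ) :
    x * y - y * x ∈ arcSpan n δ 2 := by
  have key : ∀ z ∈ centAlg n δ, permLin δ (flipEquiv n) z - z ∈ arcSpan n δ 2 := by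
    intro z hz
    rw [mem_arcSpan_iff]
    intro b hb
    rw [map_sub, coeff_permLin_flip, coeff_flip_of_mem_centAlg hz b (Or.inl (by omega)), sub_self]
  have h1 := key _ (mul_mem hx hy)
  have h2 := mul_mem_arcSpan (permLin δ (flipEquiv n) y - y) (permLin δ (flipEquiv n) x)
    (Or.inl (key y hy))
  have h3 := mul_mem_arcSpan y (permLin δ (flipEquiv n) x - x) (Or.inr (key x hx))
  rw [permLin_flip_mul] at h1
  have := Submodule.sub_mem _ (Submodule.add_mem _ h2 h3) h1
  convert this using 1
  noncomm_ring

theorem mul_comm_of_flip_invariant {x y : Alg n δ} (hx : x ∈ centAlg n δ) (hy : y ∈ centAlg n δ)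
    (H : ∀ z ∈ ({x, y, x * y} : Set (Alg n δ)), ∀ b : Diagram n,
      (upperArcs b ≤ 1 ∨ n ≤ 2 * upperArcs b + 1) ∨ (coeff b z = 0 ∧ coeff (flip b) z = 0)) :
    x * y = y * x := by
  have key : ∀ z ∈ ({x, y, x * y} : Set (Alg n δ)), z ∈ centAlg n δ →
      permLin δ (flipEquiv n) z = z := by
    intro z hz hzc
    refine ext_coeff fun b => ?_
    rw [coeff_permLin_flip]
    rcases H z hz b with h | ⟨h1, h2⟩
    · exact coeff_flip_of_mem_centAlg hzc b h
    · rw [h1, h2]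
  rw [← key (x * y) (by simp) (mul_mem hx hy), permLin_flip_mul, key x (by simp) hx,
    key y (by simp) hy]

theorem upperArcs_flip (b : Diagram n) : upperArcs (flip b) = upperArcs b := by
  rw [upperArcs_eq_lowerArcs b]
  unfold upperArcs lowerArcs
  congr 1
  ext p
  rw [Finset.mem_filter, Finset.mem_filter]
  change _ ∧ _ ∧ (b.line (.inr p.1)).swap = .inl p.2 ↔ _
  rcases b.line (.inr p.1) with j | j <;> simp

theorem mul_comm_of_le_five (hn : n ≤ 5) {x y : Alg n δ} (hx : x ∈ centAlg n δ)
    (hy : y ∈ centAlg n δ) : x * y = y * x :=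
  -- Either there is at most one arc, or two arcs give `n ≤ 5 ≤ 2 * upperArcs b + 1`.
  mul_comm_of_flip_invariant hx hy fun _ _ b => Or.inl (by omega)

theorem mul_comm_of_mem_centInter {x y : Alg n δ} (hx : x ∈ centInter n δ (n / 2))
    (hy : y ∈ centInter n δ (n / 2)) : x * y = y * x := by
  refine mul_comm_of_flip_invariant hx.1 hy.1 fun z hz b => ?_
  have hz' : z ∈ centInter n δ (n / 2) := by
    rcases hz with rfl | rfl | rfl
    · exact hx
    · exact hy
    · exact mul_mem hx hy
  have hz2 := (mem_arcSpan_iff z).1 ((mem_arcIdeal z).1 hz'.2)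
  by_cases hb : upperArcs b < n / 2
  · exact Or.inr ⟨hz2 b hb, hz2 _ (by rwa [upperArcs_flip])⟩
  · exact Or.inl (Or.inr (by omega))

/-! ### Connectedness in a stack -/

theorem conn_top {a b : Diagram n} {v w : Fin n ⊕ Fin n} (h : b.line v = w) :
    conn a b (topPart v) (topPart w) := h ▸ Relation.EqvGen.rel _ _ (Adj.top v)

theorem conn_low {a b : Diagram n} {v w : Fin n ⊕ Fin n} (h : a.line v = w) :
    conn a b (lowPart v) (lowPart w) := h ▸ Relation.EqvGen.rel _ _ (Adj.low v)

theorem upper_arc_comp (a : Diagram n) {b : Diagram n} {i j : Fin n}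
    (h : b.line (.inl i) = .inl j) : (comp a b).line (.inl i) = .inl j :=
  (comp_line_iff _ _ _ _).2 ⟨h ▸ b.line_ne _, conn_top h⟩

theorem lower_arc_comp {a : Diagram n} (b : Diagram n) {i j : Fin n}
    (h : a.line (.inr i) = .inr j) : (comp a b).line (.inr i) = .inr j :=
  (comp_line_iff _ _ _ _).2 ⟨h ▸ a.line_ne _, conn_low h⟩

theorem two_mul_upperArcs (b : Diagram n) :
    2 * upperArcs b = (Finset.univ.filter fun i : Fin n => ∃ j, b.line (.inl i) = .inl j).card :=
  arcs_count Sum.inl Sum.inl_injective b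

theorem two_mul_lowerArcs (b : Diagram n) :
    2 * lowerArcs b = (Finset.univ.filter fun i : Fin n => ∃ j, b.line (.inr i) = .inr j).card :=
  arcs_count Sum.inr Sum.inr_injective b

/-- The upper arcs of the top diagram survive in the product; if the numbers agree, their ends
already exhaust the ends of upper arcs. -/
theorem upper_arc_iff {a b : Diagram n} (h : upperArcs (comp a b) = upperArcs b) {i j : Fin n} :
    (comp a b).line (.inl i) = .inl j ↔ b.line (.inl i) = .inl j := by
  refine ⟨fun hc => ?_, upper_arc_comp a⟩
  have hs : (Finset.univ.filter fun i : Fin n => ∃ j, b.line (.inl i) = .inl j) ⊆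
      Finset.univ.filter fun i : Fin n => ∃ j, (comp a b).line (.inl i) = .inl j := by
    intro k hk
    obtain ⟨l, hl⟩ := (Finset.mem_filter.1 hk).2
    exact Finset.mem_filter.2 ⟨Finset.mem_univ _, l, upper_arc_comp a hl⟩
  have he := Finset.eq_of_subset_of_card_le hs (by
    rw [← two_mul_upperArcs, ← two_mul_upperArcs, h])
  have hi : i ∈ Finset.univ.filter fun i : Fin n => ∃ j, b.line (.inl i) = .inl j := by
    rw [he]
    exact Finset.mem_filter.2 ⟨Finset.mem_univ _, j, hc⟩
  obtain ⟨k, hk⟩ := (Finset.mem_filter.1 hi).2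
  rw [hk, ← upper_arc_comp a hk, hc]

theorem lower_arc_iff {a b : Diagram n} (h : upperArcs (comp a b) = upperArcs a) {i j : Fin n} :
    (comp a b).line (.inr i) = .inr j ↔ a.line (.inr i) = .inr j := by
  refine ⟨fun hc => ?_, lower_arc_comp b⟩
  have hs : (Finset.univ.filter fun i : Fin n => ∃ j, a.line (.inr i) = .inr j) ⊆
      Finset.univ.filter fun i : Fin n => ∃ j, (comp a b).line (.inr i) = .inr j := by
    intro k hk
    obtain ⟨l, hl⟩ := (Finset.mem_filter.1 hk).2
    exact Finset.mem_filter.2 ⟨Finset.mem_univ _, l, lower_arc_comp b hl⟩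
  have he := Finset.eq_of_subset_of_card_le hs (by
    rw [← two_mul_lowerArcs, ← two_mul_lowerArcs, ← upperArcs_eq_lowerArcs,
      ← upperArcs_eq_lowerArcs, h])
  have hi : i ∈ Finset.univ.filter fun i : Fin n => ∃ j, a.line (.inr i) = .inr j := by
    rw [he]
    exact Finset.mem_filter.2 ⟨Finset.mem_univ _, j, hc⟩
  obtain ⟨k, hk⟩ := (Finset.mem_filter.1 hi).2
  rw [hk, ← lower_arc_comp b hk, hc]

/-- A node of the middle row of a stack. -/
abbrev mid (i : Fin n) : Stack n := .inr (.inl i)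

/-- `I` is a system of representatives, among the middle nodes, of the components that are loops. -/
theorem loops_eq_card {a b : Diagram n} (I : Set (Fin n))
    (hI : ∀ i ∈ I, ∀ j ∈ I, conn a b (mid i) (mid j) → i = j)
    (hO : ∀ i ∈ I, ∀ v, ¬ conn a b (mid i) (outer v))
    (h : ∀ i, (∃ v, conn a b (mid i) (outer v)) ∨ ∃ j ∈ I, conn a b (mid i) (mid j)) :
    loops a b = Nat.card I := by
  symm
  refine Nat.card_congr (Equiv.ofBijective (fun i : I => ⟨Quotient.mk (conn a b) (mid i.1), ?_⟩)
    ⟨?_, ?_⟩)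
  · rintro ⟨v, hv⟩
    exact hO i.1 i.2 v ((conn a b).symm (Quotient.exact hv))
  · intro i j hij
    exact Subtype.ext (hI _ i.2 _ j.2 (Quotient.exact (Subtype.ext_iff.1 hij)))
  · rintro ⟨q, hq⟩
    induction q using Quotient.inductionOn with
    | h x =>
      rcases x with i | i | i
      · exact absurd ⟨.inl i, rfl⟩ hq
      · rcases h i with ⟨v, hv⟩ | ⟨j, hj, hc⟩
        · exact absurd ⟨v, Quotient.sound (s := conn a b) ((conn a b).symm hv)⟩ hq
        · exact ⟨⟨j, hj⟩, Subtype.ext (Quotient.sound (s := conn a b) ((conn a b).symm hc))⟩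
      · exact absurd ⟨.inr i, rfl⟩ hq

/-- An arc present on both sides of the middle row closes up to a loop with just these two nodes. -/
theorem conn_mid_pair {a b : Diagram n} {i j : Fin n} (ha : a.line (.inl i) = .inl j)
    (hb : b.line (.inr i) = .inr j) {x : Stack n} (h : conn a b (mid i) x) :
    x = mid i ∨ x = mid j := by
  have ha' : a.line (.inl j) = .inl i := by rw [← ha, a.line_line]
  have hb' : b.line (.inr j) = .inr i := by rw [← hb, b.line_line]
  rw [conn_iff] at h
  have l1 : lowFun a (mid i) = mid j := by simp [lowFun, ha, lowPart_eq]
  have l2 : lowFun a (mid j) = mid i := by simp [lowFun, ha', lowPart_eq]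
  have t1 : topFun b (mid i) = mid j := by simp [topFun, hb, topPart]
  have t2 : topFun b (mid j) = mid i := by simp [topFun, hb', topPart]
  have key : ∀ u v, Relation.EqvGen (fun u v => v = lowFun a u ∨ v = topFun b u) u v →
      ((u = mid i ∨ u = mid j) ↔ (v = mid i ∨ v = mid j)) := by
    intro u v h
    induction h with
    | rel u v h =>
      rcases h with rfl | rfl
      · constructor
        · rintro (rfl | rfl)
          · exact Or.inr l1
          · exact Or.inl l2
        · rintro (h | h)
          · right; rw [← lowFun_lowFun a u, h, l1]
          · left; rw [← lowFun_lowFun a u, h, l2]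
      · constructor
        · rintro (rfl | rfl)
          · exact Or.inr t1
          · exact Or.inl t2
        · rintro (h | h)
          · right; rw [← topFun_topFun b u, h, t1]
          · left; rw [← topFun_topFun b u, h, t2]
    | refl => exact Iff.rfl
    | symm _ _ _ ih => exact ih.symm
    | trans _ _ _ _ _ ih1 ih2 => exact ih1.trans ih2
  exact (key _ _ h).1 (Or.inl rfl)

/-! ### Sums over conjugation invariant families of diagrams -/

theorem conj_line_inl_iff (s : Equiv.Perm (Fin n)) (b : Diagram n) (i j : Fin n) :
    (conj s b).line (.inl (s i)) = .inl (s j) ↔ b.line (.inl i) = .inl j := by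
  rw [show (Sum.inl (s i) : Fin n ⊕ Fin n) = moveNode s (.inl i) from rfl, conj_line_moveNode,
    show (Sum.inl (s j) : Fin n ⊕ Fin n) = moveNode s (.inl j) from rfl, (moveNode s).apply_eq_iff_eq]

theorem conj_line_inr_iff (s : Equiv.Perm (Fin n)) (b : Diagram n) (i j : Fin n) :
    (conj s b).line (.inr (s i)) = .inr (s j) ↔ b.line (.inr i) = .inr j := by
  rw [show (Sum.inr (s i) : Fin n ⊕ Fin n) = moveNode s (.inr i) from rfl, conj_line_moveNode,
    show (Sum.inr (s j) : Fin n ⊕ Fin n) = moveNode s (.inr j) from rfl, (moveNode s).apply_eq_iff_eq]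

theorem exists_conj_inl_iff (s : Equiv.Perm (Fin n)) (b : Diagram n) (i : Fin n) :
    (∃ j, (conj s b).line (.inl (s i)) = .inl j) ↔ ∃ j, b.line (.inl i) = .inl j :=
  s.surjective.exists.trans (exists_congr fun j => conj_line_inl_iff s b i j)

theorem exists_conj_inr_iff (s : Equiv.Perm (Fin n)) (b : Diagram n) (i : Fin n) :
    (∃ j, (conj s b).line (.inr (s i)) = .inr j) ↔ ∃ j, b.line (.inr i) = .inr j :=
  s.surjective.exists.trans (exists_congr fun j => conj_line_inr_iff s b i j)

theorem upperArcs_conj (s : Equiv.Perm (Fin n)) (b : Diagram n) :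
    upperArcs (conj s b) = upperArcs b := by
  have : 2 * upperArcs (conj s b) = 2 * upperArcs b := by
    rw [two_mul_upperArcs, two_mul_upperArcs]
    symm
    refine Finset.card_equiv s fun i => ?_
    simp only [Finset.mem_filter, Finset.mem_univ, true_and]
    exact (exists_conj_inl_iff s b i).symm
  omega

/-- The diagrams with `f` arcs whose upper and lower arcs agree. -/
def sameArcs (n f : ℕ) : Set (Diagram n) :=
  {b | upperArcs b = f ∧ ∀ i j, b.line (.inl i) = .inl j ↔ b.line (.inr i) = .inr j}

/-- The number of nodes on a common arc of the two rows. -/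
def commonNodes (b : Diagram n) : ℕ :=
  (Finset.univ.filter fun i : Fin n => ∃ j, b.line (.inl i) = .inl j ∧
    b.line (.inr i) = .inr j).card

/-- The diagrams with `f` arcs whose upper and lower arcs have the same ends, at least `r` of which
are on a common arc. -/
def sameEnds (n f r : ℕ) : Set (Diagram n) :=
  {b | upperArcs b = f ∧ (∀ i, (∃ j, b.line (.inl i) = .inl j) ↔ ∃ j, b.line (.inr i) = .inr j) ∧
    r ≤ commonNodes b}

theorem conj_mem_sameArcs {f : ℕ} (s : Equiv.Perm (Fin n)) {b : Diagram n}
    (hb : b ∈ sameArcs n f) : conj s b ∈ sameArcs n f := by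
  refine ⟨(upperArcs_conj s b).trans hb.1, fun i j => ?_⟩
  obtain ⟨i, rfl⟩ := s.surjective i
  obtain ⟨j, rfl⟩ := s.surjective j
  rw [conj_line_inl_iff, conj_line_inr_iff]
  exact hb.2 i j

theorem conj_mem_sameEnds {f r : ℕ} (s : Equiv.Perm (Fin n)) {b : Diagram n}
    (hb : b ∈ sameEnds n f r) : conj s b ∈ sameEnds n f r := by
  refine ⟨(upperArcs_conj s b).trans hb.1, fun i => ?_, ?_⟩
  · obtain ⟨i, rfl⟩ := s.surjective i
    rw [exists_conj_inl_iff, exists_conj_inr_iff]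
    exact hb.2.1 i
  · refine hb.2.2.trans_eq (Finset.card_equiv s fun i => ?_)
    simp only [Finset.mem_filter, Finset.mem_univ, true_and]
    rw [s.surjective.exists (p := fun j => (conj s b).line (.inl (s i)) = .inl j ∧ _)]
    simp only [conj_line_inl_iff, conj_line_inr_iff]

open Classical in
/-- The sum of the diagrams in a set. -/
noncomputable def setSum (δ : ℂ) (S : Set (Diagram n)) : Alg n δ :=
  ∑ b, if b ∈ S then Alg.diag δ b else 0

open Classical in
theorem coeff_setSum (S : Set (Diagram n)) (b : Diagram n) :
    coeff b (setSum δ S) = if b ∈ S then 1 else 0 := by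
  rw [setSum, map_sum, Finset.sum_eq_single b]
  · split_ifs <;> simp [coeff_diag]
  · intro a _ hab
    split_ifs <;> simp [coeff_diag, hab]
  · simp

theorem setSum_mem_centAlg {S : Set (Diagram n)} (h : ∀ s, ∀ b ∈ S, conj s b ∈ S) :
    setSum δ S ∈ centAlg n δ := by
  classical
  rw [mem_centAlg_iff]
  intro s b
  rw [coeff_setSum, coeff_setSum]
  congr 1
  refine propext ⟨fun hb => ?_, h s b⟩
  have := h s⁻¹ _ hb
  rwa [conj_conj, inv_mul_cancel, conj_one] at this

theorem setSum_mem_arcSpan {S : Set (Diagram n)} {f : ℕ} (h : ∀ b ∈ S, f ≤ upperArcs b) :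
    setSum δ S ∈ arcSpan n δ f := by
  classical
  refine Submodule.sum_mem _ fun b _ => ?_
  split_ifs with hb
  · exact Submodule.subset_span ⟨b, h b hb, rfl⟩
  · exact Submodule.zero_mem _

open Classical in
theorem coeff_setSum_mul (S T : Set (Diagram n)) (d : Diagram n) :
    coeff d (setSum δ S * setSum δ T) =
      ∑ a, ∑ b, if a ∈ S ∧ b ∈ T ∧ comp a b = d then δ ^ loops a b else 0 := by
  rw [setSum, setSum, Finset.sum_mul_sum, map_sum]
  refine Finset.sum_congr rfl fun a _ => ?_
  rw [map_sum]
  refine Finset.sum_congr rfl fun b _ => ?_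
  by_cases ha : a ∈ S <;> by_cases hb : b ∈ T <;> by_cases hd : comp a b = d <;>
    simp [ha, hb, hd, Alg.diag_mul_diag, coeff_diag]

/-- All contributions are natural multiples of one nonzero constant `c`, so in characteristic zero
nothing cancels the term of the given pair. -/
theorem coeff_setSum_mul_ne_zero {S T : Set (Diagram n)} {a₀ b₀ : Diagram n} (ha : a₀ ∈ S)
    (hb : b₀ ∈ T) (w : Diagram n → Diagram n → ℕ) (c : ℂ) (hc : c ≠ 0) (hw : w a₀ b₀ ≠ 0)
    (h : ∀ a ∈ S, ∀ b ∈ T, comp a b = comp a₀ b₀ → δ ^ loops a b = w a b * c) :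
    coeff (comp a₀ b₀) (setSum δ S * setSum δ T) ≠ 0 := by
  classical
  have e : coeff (comp a₀ b₀) (setSum δ S * setSum δ T) =
      ((∑ a, ∑ b, if a ∈ S ∧ b ∈ T ∧ comp a b = comp a₀ b₀ then w a b else 0 : ℕ) : ℂ) * c := by
    rw [coeff_setSum_mul]
    push_cast
    simp only [Finset.sum_mul]
    refine Finset.sum_congr rfl fun a _ => Finset.sum_congr rfl fun b _ => ?_
    split_ifs with hab
    · exact h a hab.1 b hab.2.1 hab.2.2
    · rw [zero_mul]
  rw [e]
  refine mul_ne_zero (Nat.cast_ne_zero.2 fun h0 => hw ?_) hc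
  rw [Finset.sum_eq_zero_iff] at h0
  have := Finset.sum_eq_zero_iff.1 (h0 a₀ (Finset.mem_univ _)) b₀ (Finset.mem_univ _)
  rwa [if_pos ⟨ha, hb, rfl⟩] at this

/-- If the lower diagram has the through lines at `u` and `v`, which the upper one joins by a lower
arc, then the product has a new lower arc. -/
theorem not_lower_arc {a b : Diagram n}
    (hlow : ∀ i j, (comp a b).line (.inr i) = .inr j → a.line (.inr i) = .inr j) {u v s t : Fin n}
    (hu : a.line (.inl u) = .inr s) (hv : a.line (.inl v) = .inr t) :
    b.line (.inr u) ≠ .inr v := by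
  intro h
  have hst : (Sum.inr t : Fin n ⊕ Fin n) ≠ .inr s := by
    intro e
    rw [← hu, ← hv] at e
    have := congrArg a.line e
    rw [a.line_line, a.line_line] at this
    exact (h ▸ b.line_ne (.inr u)) (congrArg Sum.inr (Sum.inl_injective this))
  have hs : a.line (.inr s) = .inl u := by rw [← hu, a.line_line]
  have hc : conn a b (outer (.inr s)) (outer (.inr t)) :=
    (conn a b).trans (conn_low hs) ((conn a b).trans (conn_top h) (conn_low hv))
  have h2 := hlow _ _ ((comp_line_iff _ _ _ _).2 ⟨hst, hc⟩)
  rw [hs] at h2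
  cases h2

/-- The upper arc `{u, v}` of `d` comes from `b`, hence is also a lower arc of `b`. The lower nodes
`u`, `v` of `d` are on through lines, so they are not arc ends in `a`, and `a` has through lines at
its upper nodes `u`, `v` too. The arc of `b` would join these into an additional lower arc, although
`d` has only `f` arcs. -/
theorem comp_ne_of_sameEnds_of_sameArcs {f r : ℕ} {d : Diagram n} (hd : upperArcs d = f)
    {u v x y : Fin n} (huv : d.line (.inl u) = .inl v) (hu : d.line (.inr u) = .inl x)
    (hv : d.line (.inr v) = .inl y) :
    ∀ a ∈ sameEnds n f r, ∀ b ∈ sameArcs n f, comp a b ≠ d := by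
  rintro a ha b hb rfl
  have hup := @upper_arc_iff _ a b (hd.trans hb.1.symm)
  have hlow := @lower_arc_iff _ a b (hd.trans ha.1.symm)
  have h1 : b.line (.inr u) = .inr v := (hb.2 u v).1 (hup.1 huv)
  have through : ∀ {w z}, (comp a b).line (.inr w) = .inl z → ∃ t, a.line (.inl w) = .inr t := by
    intro w z hw
    rcases h : a.line (.inl w) with k | k
    · obtain ⟨j, hj⟩ := (ha.2.1 w).1 ⟨k, h⟩
      rw [lower_arc_comp b hj] at hw
      cases hw
    · exact ⟨k, rfl⟩
  obtain ⟨s, hs⟩ := through hu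
  obtain ⟨t, ht⟩ := through hv
  exact not_lower_arc (fun _ _ => hlow.1) hs ht h1

/-- The product diagram of `a₀` and `b₀` has only `f` arcs, so its coefficient detects the
commutator modulo `J^(f+1)`. That coefficient is nonzero in one order and vanishes in the other. -/
theorem commutator_not_mem {f r : ℕ} {a₀ b₀ : Diagram n} (ha : a₀ ∈ sameArcs n f)
    (hb : b₀ ∈ sameEnds n f r) (hd : upperArcs (comp a₀ b₀) = f)
    {u v x y : Fin n} (huv : (comp a₀ b₀).line (.inl u) = .inl v)
    (hu : (comp a₀ b₀).line (.inr u) = .inl x) (hv : (comp a₀ b₀).line (.inr v) = .inl y)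
    (w : Diagram n → Diagram n → ℕ) (c : ℂ) (hc : c ≠ 0) (hw : w a₀ b₀ ≠ 0)
    (h : ∀ a ∈ sameArcs n f, ∀ b ∈ sameEnds n f r, comp a b = comp a₀ b₀ →
      δ ^ loops a b = w a b * c) :
    ∃ x y : Alg n δ, x ∈ centAlg n δ ∧ y ∈ centAlg n δ ∧ x ∈ arcSpan n δ f ∧
      y ∈ arcSpan n δ f ∧ x * y - y * x ∉ arcSpan n δ (f + 1) := by
  classical
  refine ⟨setSum δ (sameArcs n f), setSum δ (sameEnds n f r),
    setSum_mem_centAlg fun s b hb => conj_mem_sameArcs s hb,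
    setSum_mem_centAlg fun s b hb => conj_mem_sameEnds s hb,
    setSum_mem_arcSpan fun b hb => hb.1.ge, setSum_mem_arcSpan fun b hb => hb.1.ge, fun hmem => ?_⟩
  have h0 := (mem_arcSpan_iff _).1 hmem (comp a₀ b₀) (by omega)
  rw [map_sub, coeff_setSum_mul (sameEnds n f r), Finset.sum_eq_zero, sub_zero] at h0
  · exact coeff_setSum_mul_ne_zero ha hb w c hc hw h h0
  · intro a _
    refine Finset.sum_eq_zero fun b _ => if_neg ?_
    rintro ⟨h1, h2, h3⟩
    exact comp_ne_of_sameEnds_of_sameArcs hd huv hu hv a h1 b h2 h3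

/-! ### Diagrams without bent through lines -/

/-- The diagram with the arcs `{i, u i}` in the upper and `{i, l i}` in the lower row, and with
vertical through lines. -/
def rowDiagram (n : ℕ) (u l : ℕ → ℕ) (hu : ∀ i < n, u i < n ∧ u (u i) = i)
    (hl : ∀ i < n, l i < n ∧ l (l i) = i) (h : ∀ i, u i = i ↔ l i = i) : Diagram n where
  line
    | .inl i => if u i = i then .inr i else .inl ⟨u i, (hu i i.2).1⟩
    | .inr i => if l i = i then .inl i else .inr ⟨l i, (hl i i.2).1⟩
  line_line := by
    rintro (i | i)
    · by_cases hi : u i = i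
      · simp [hi, (h i).1 hi]
      · simp [hi, (hu i i.2).2, Ne.symm hi]
    · by_cases hi : l i = i
      · simp [hi, (h i).2 hi]
      · simp [hi, (hl i i.2).2, Ne.symm hi]
  line_ne := by
    rintro (i | i)
    · by_cases hi : u i = i
      · simp [hi]
      · simp [hi, Fin.ext_iff]
    · by_cases hi : l i = i
      · simp [hi]
      · simp [hi, Fin.ext_iff]

section

variable {u l : ℕ → ℕ} {hu : ∀ i < n, u i < n ∧ u (u i) = i}
  {hl : ∀ i < n, l i < n ∧ l (l i) = i} {h : ∀ i, u i = i ↔ l i = i}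

theorem rowDiagram_inl_iff (i j : Fin n) :
    (rowDiagram n u l hu hl h).line (.inl i) = .inl j ↔ u i = j ∧ u i ≠ i := by
  by_cases hi : u i = i <;> simp [rowDiagram, hi, Fin.ext_iff]

theorem rowDiagram_inr_iff (i j : Fin n) :
    (rowDiagram n u l hu hl h).line (.inr i) = .inr j ↔ l i = j ∧ l i ≠ i := by
  by_cases hi : l i = i <;> simp [rowDiagram, hi, Fin.ext_iff]

theorem rowDiagram_inl_of_eq {i : Fin n} (hi : u i = i) :
    (rowDiagram n u l hu hl h).line (.inl i) = .inr i := by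
  simp [rowDiagram, hi]

theorem rowDiagram_inr_of_eq {i : Fin n} (hi : l i = i) :
    (rowDiagram n u l hu hl h).line (.inr i) = .inl i := by
  simp [rowDiagram, hi]

theorem card_filter_fin (P : ℕ → Prop) [DecidablePred P] :
    (Finset.univ.filter fun i : Fin n => P i).card = ((Finset.range n).filter P).card := by
  rw [← Finset.card_map Fin.valEmbedding]
  congr 1
  ext k
  simp only [Finset.mem_map, Finset.mem_filter, Finset.mem_univ, true_and, Fin.valEmbedding_apply,
    Finset.mem_range]
  constructor
  · rintro ⟨i, hi, rfl⟩; exact ⟨i.2, hi⟩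
  · rintro ⟨h1, h2⟩; exact ⟨⟨k, h1⟩, h2, rfl⟩

theorem two_mul_upperArcs_rowDiagram :
    2 * upperArcs (rowDiagram n u l hu hl h) = ((Finset.range n).filter fun i => u i ≠ i).card := by
  rw [two_mul_upperArcs, ← card_filter_fin]
  congr 1
  ext i
  simp only [Finset.mem_filter, Finset.mem_univ, true_and, rowDiagram_inl_iff]
  exact ⟨fun ⟨_, hj⟩ => hj.2, fun hi => ⟨⟨u i, (hu i i.2).1⟩, rfl, hi⟩⟩

end

/-! ### Four matchings -/

/-- The matching `{0, 1}, {3, 4}, {5, 6}, …, {2 f - 1, 2 f}`. -/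
def matchA (f i : ℕ) : ℕ :=
  if i = 0 then 1 else if i = 1 then 0 else if i = 2 ∨ 2 * f < i then i
  else if i % 2 = 1 then i + 1 else i - 1

/-- The matching `{1, 4}, {2, 2 f + 1}, {5, 6}, …, {2 f - 1, 2 f}`. -/
def matchB (f i : ℕ) : ℕ :=
  if i = 1 then 4 else if i = 4 then 1 else if i = 2 then 2 * f + 1
  else if i = 2 * f + 1 then 2 else if i < 5 ∨ 2 * f + 1 < i then i
  else if i % 2 = 1 then i + 1 else i - 1

/-- The matching `{1, 2}, {4, 2 f + 1}, {5, 6}, …, {2 f - 1, 2 f}`. -/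
def matchC (f i : ℕ) : ℕ :=
  if i = 1 then 2 else if i = 2 then 1 else if i = 4 then 2 * f + 1
  else if i = 2 * f + 1 then 4 else if i < 5 ∨ 2 * f + 1 < i then i
  else if i % 2 = 1 then i + 1 else i - 1

/-- The matching `{1, 2}, {4, 5}, {6, 7}, …, {2 f, 2 f + 1}`. -/
def matchD (f i : ℕ) : ℕ :=
  if i = 1 then 2 else if i = 2 then 1 else if i < 4 ∨ 2 * f + 1 < i then i
  else if i % 2 = 0 then i + 1 else i - 1

section Matchings

variable {f : ℕ} (hf : 2 ≤ f) (hn : 2 * f + 2 ≤ n)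

theorem matchA_matchA (i : ℕ) : matchA f (matchA f i) = i := by
  obtain ⟨j, hj⟩ : ∃ j, matchA f i = j := ⟨_, rfl⟩
  rw [hj]
  unfold matchA at hj ⊢
  split_ifs at hj <;> grind

theorem matchD_matchD (i : ℕ) : matchD f (matchD f i) = i := by
  obtain ⟨j, hj⟩ : ∃ j, matchD f i = j := ⟨_, rfl⟩
  rw [hj]
  unfold matchD at hj ⊢
  split_ifs at hj <;> grind

include hf

theorem matchB_matchB (i : ℕ) : matchB f (matchB f i) = i := by
  obtain ⟨j, hj⟩ : ∃ j, matchB f i = j := ⟨_, rfl⟩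
  rw [hj]
  unfold matchB at hj ⊢
  split_ifs at hj <;> grind

theorem matchC_matchC (i : ℕ) : matchC f (matchC f i) = i := by
  obtain ⟨j, hj⟩ : ∃ j, matchC f i = j := ⟨_, rfl⟩
  rw [hj]
  unfold matchC at hj ⊢
  split_ifs at hj <;> grind

theorem matchA_eq_iff (i : ℕ) : matchA f i = i ↔ i = 2 ∨ 2 * f < i := by
  unfold matchA; grind

theorem matchB_eq_iff (i : ℕ) : matchB f i = i ↔ i = 0 ∨ i = 3 ∨ 2 * f + 1 < i := by
  unfold matchB; grind

theorem matchC_eq_iff (i : ℕ) : matchC f i = i ↔ i = 0 ∨ i = 3 ∨ 2 * f + 1 < i := by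
  unfold matchC; grind

theorem matchD_eq_iff (i : ℕ) : matchD f i = i ↔ i = 0 ∨ i = 3 ∨ 2 * f + 1 < i := by
  unfold matchD; grind

include hn

theorem matchA_lt (i : ℕ) (hi : i < n) : matchA f i < n := by
  unfold matchA; grind

theorem matchB_lt (i : ℕ) (hi : i < n) : matchB f i < n := by
  unfold matchB; grind

theorem matchC_lt (i : ℕ) (hi : i < n) : matchC f i < n := by
  unfold matchC; grind

theorem matchD_lt (i : ℕ) (hi : i < n) : matchD f i < n := by
  unfold matchD; grind

theorem card_matchA : ((Finset.range n).filter fun i => matchA f i ≠ i).card = 2 * f := by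
  have : ((Finset.range n).filter fun i => matchA f i ≠ i) = (Finset.range (2 * f + 1)).erase 2 := by
    ext i
    simp only [Finset.mem_filter, Finset.mem_range, Finset.mem_erase, ne_eq, matchA_eq_iff hf]
    omega
  rw [this, Finset.card_erase_of_mem (Finset.mem_range.2 (by omega)), Finset.card_range]
  omega

theorem card_matchB : ((Finset.range n).filter fun i => matchB f i ≠ i).card = 2 * f := by
  have : ((Finset.range n).filter fun i => matchB f i ≠ i) =
      ((Finset.range (2 * f + 2)).erase 3).erase 0 := by
    ext i
    simp only [Finset.mem_filter, Finset.mem_range, Finset.mem_erase, ne_eq, matchB_eq_iff hf]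
    omega
  rw [this, Finset.card_erase_of_mem, Finset.card_erase_of_mem (Finset.mem_range.2 (by omega)),
    Finset.card_range]
  · omega
  · simp

end Matchings

variable {f : ℕ}

theorem matchA_of_mem {i : ℕ} (h5 : 5 ≤ i) (hi : i ≤ 2 * f) :
    matchA f i = if i % 2 = 1 then i + 1 else i - 1 := by
  unfold matchA; grind

theorem matchB_of_mem {i : ℕ} (h5 : 5 ≤ i) (hi : i ≤ 2 * f) :
    matchB f i = if i % 2 = 1 then i + 1 else i - 1 := by
  unfold matchB; grind

theorem matchC_of_mem {i : ℕ} (h5 : 5 ≤ i) (hi : i ≤ 2 * f) :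
    matchC f i = if i % 2 = 1 then i + 1 else i - 1 := by
  unfold matchC; grind

/-! ### Through lines and the number of loops -/

theorem exists_line_inl_eq_inr {b : Diagram n} {i : Fin n} (h : ¬ ∃ j, b.line (.inl i) = .inl j) :
    ∃ j, b.line (.inl i) = .inr j := by
  rcases hb : b.line (.inl i) with j | j
  · exact absurd ⟨j, hb⟩ h
  · exact ⟨j, rfl⟩

theorem exists_line_inr_eq_inl {b : Diagram n} {i : Fin n} (h : ¬ ∃ j, b.line (.inr i) = .inr j) :
    ∃ j, b.line (.inr i) = .inl j := by
  rcases hb : b.line (.inr i) with j | j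
  · exact ⟨j, rfl⟩
  · exact absurd ⟨j, hb⟩ h

/-- If the upper diagram has through lines at two distinct nodes, these are not connected
in a product without new upper arcs. -/
theorem not_conn_of_through {a b : Diagram n}
    (hup : ∀ i j, (comp a b).line (.inl i) = .inl j → b.line (.inl i) = .inl j) {u v s t : Fin n}
    (huv : u ≠ v) (hu : b.line (.inr u) = .inl s) (hv : b.line (.inr v) = .inl t) :
    ¬ conn a b (mid u) (mid v) := by
  intro h
  have hst : (Sum.inl t : Fin n ⊕ Fin n) ≠ .inl s := by
    intro e
    rw [← hu, ← hv] at e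
    have := congrArg b.line e
    rw [b.line_line, b.line_line] at this
    exact huv (Sum.inr_injective this).symm
  have hs : b.line (.inl s) = .inr u := by rw [← hu, b.line_line]
  have hc : conn a b (outer (.inl s)) (outer (.inl t)) :=
    (conn a b).trans (conn_top hs) ((conn a b).trans h (conn_top hv))
  have h2 := hup _ _ ((comp_line_iff _ _ _ _).2 ⟨hst, hc⟩)
  rw [hs] at h2
  cases h2

/-- Of the upper arcs of `b`, neither `{1, 4}` nor `{2, 2 f + 1}` can also be a lower arc without
creating a new arc in the product. So the `2 f - 4` common nodes are exactly `5, …, 2 f`. The common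
arcs on them close up with the arcs of `a` to loops, counted by their odd ends, and all other middle
nodes lead to outer nodes. -/
theorem loops_eq_of_commonNodes (hf : 2 ≤ f) (hn : 2 * f + 2 ≤ n) {a b : Diagram n}
    (ha : ∀ i j : Fin n, a.line (.inl i) = .inl j ↔ matchA f i = j ∧ matchA f i ≠ i)
    (hb : ∀ i j : Fin n, b.line (.inl i) = .inl j ↔ matchB f i = j ∧ matchB f i ≠ i)
    (hends : ∀ i, (∃ j, b.line (.inl i) = .inl j) ↔ ∃ j, b.line (.inr i) = .inr j)
    (hcommon : 2 * f - 4 ≤ commonNodes b)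
    (hup : ∀ i j, (comp a b).line (.inl i) = .inl j → b.line (.inl i) = .inl j)
    (hlow : ∀ i j, (comp a b).line (.inr i) = .inr j → a.line (.inr i) = .inr j) :
    loops a b = Nat.card {i : Fin n | 5 ≤ i.1 ∧ i.1 ≤ 2 * f ∧ i.1 % 2 = 1} := by
  classical
  have hathr : ∀ i : Fin n, matchA f i = i → ∃ k, a.line (.inl i) = .inr k := fun i hi =>
    exists_line_inl_eq_inr fun ⟨j, hj⟩ => ((ha i j).1 hj).2 hi
  have hbthr : ∀ i : Fin n, matchB f i = i → ∃ k, b.line (.inr i) = .inl k := fun i hi =>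
    exists_line_inr_eq_inl fun h => by
      obtain ⟨j, hj⟩ := (hends i).2 h
      exact ((hb i j).1 hj).2 hi
  let N : (k : ℕ) → k < 2 * f + 2 → Fin n := fun k hk => ⟨k, by omega⟩
  have h01 : a.line (.inl (N 0 (by omega))) = .inl (N 1 (by omega)) :=
    (ha _ _).2 (by simp [N, matchA])
  have h34 : a.line (.inl (N 3 (by omega))) = .inl (N 4 (by omega)) :=
    (ha _ _).2 (by simp only [N, matchA]; grind)
  obtain ⟨k0, hk0⟩ := hbthr (N 0 (by omega)) ((matchB_eq_iff hf _).2 (Or.inl rfl))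
  obtain ⟨k3, hk3⟩ := hbthr (N 3 (by omega)) ((matchB_eq_iff hf _).2 (Or.inr (Or.inl rfl)))
  obtain ⟨k2, hk2⟩ := hathr (N 2 (by omega)) ((matchA_eq_iff hf _).2 (Or.inl rfl))
  obtain ⟨k5, hk5⟩ := hathr (N (2 * f + 1) (by omega))
    ((matchA_eq_iff hf _).2 (Or.inr (Nat.lt_succ_self _)))
  -- A lower arc `{1, 4}` of `b` would link its through lines at `0` and `3` along `0, 1, 4, 3`.
  have hn14 : b.line (.inr (N 1 (by omega))) ≠ .inr (N 4 (by omega)) := fun h =>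
    not_conn_of_through hup (by simp [N]) hk0 hk3
      ((conn a b).trans (conn_low h01) ((conn a b).trans (conn_top h)
        ((conn a b).symm (conn_low h34))))
  have hn41 : b.line (.inr (N 4 (by omega))) ≠ .inr (N 1 (by omega)) := fun h =>
    hn14 (by rw [← h, b.line_line])
  -- `a` has through lines at both `2` and `2 f + 1`, which no lower arc of `b` may join.
  have hn25 := not_lower_arc (b := b) hlow hk2 hk5
  have hn52 := not_lower_arc (b := b) hlow hk5 hk2
  let K := Finset.univ.filter fun i : Fin n => ∃ j, b.line (.inl i) = .inl j ∧
    b.line (.inr i) = .inr j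
  let R := Finset.univ.filter fun i : Fin n => 5 ≤ i.1 ∧ i.1 ≤ 2 * f
  have hKR : K ⊆ R := by
    intro i hi
    obtain ⟨j, hj1, hj2⟩ := (Finset.mem_filter.1 hi).2
    obtain ⟨hj, hne⟩ := (hb i j).1 hj1
    refine Finset.mem_filter.2 ⟨Finset.mem_univ _, ?_⟩
    have e : ∀ k l hk hl, i.1 = k → matchB f k = l → b.line (.inr (N k hk)) = .inr (N l hl) := by
      rintro k l hk hl rfl h2
      have : j = N l hl := Fin.ext (hj.symm.trans h2)
      rw [← this]
      exact hj2
    rw [Ne, matchB_eq_iff hf] at hne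
    have c1 : i.1 ≠ 1 := fun h => hn14 (e 1 4 (by omega) (by omega) h (by simp [matchB]))
    have c4 : i.1 ≠ 4 := fun h => hn41 (e 4 1 (by omega) (by omega) h (by simp [matchB]))
    have c2 : i.1 ≠ 2 := fun h => hn25 (e 2 (2 * f + 1) (by omega) (by omega) h (by simp [matchB]))
    have c5 : i.1 ≠ 2 * f + 1 := fun h => hn52 (e (2 * f + 1) 2 (by omega) (by omega) h (by unfold matchB; grind))
    omega
  have hRcard : R.card = 2 * f - 4 := by
    have : ((Finset.range n).filter fun i => 5 ≤ i ∧ i ≤ 2 * f) = Finset.Icc 5 (2 * f) := by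
      ext i
      simp only [Finset.mem_filter, Finset.mem_range, Finset.mem_Icc]
      omega
    rw [card_filter_fin (fun i => 5 ≤ i ∧ i ≤ 2 * f), this, Nat.card_Icc]
    omega
  have hK : K = R := Finset.eq_of_subset_of_card_le hKR (hRcard.trans_le hcommon)
  have hR : ∀ i j : Fin n, 5 ≤ i.1 → i.1 ≤ 2 * f → matchB f i = j →
      b.line (.inr i) = .inr j ∧ a.line (.inl i) = .inl j := by
    intro i j h5 h6 hj
    have hi : i ∈ K := hK ▸ Finset.mem_filter.2 ⟨Finset.mem_univ _, h5, h6⟩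
    obtain ⟨k, hk1, hk2⟩ := (Finset.mem_filter.1 hi).2
    have hk := (hb i k).1 hk1
    have hkj : k = j := Fin.ext (hk.1.symm.trans hj)
    subst hkj
    have e : matchA f i = matchB f i := by rw [matchA_of_mem h5 h6, matchB_of_mem h5 h6]
    exact ⟨hk2, (ha _ _).2 (by rw [e]; exact hk)⟩
  have pair : ∀ i j : Fin n, 5 ≤ i.1 → i.1 ≤ 2 * f → matchB f i = j → ∀ x,
      conn a b (mid i) x → x = mid i ∨ x = mid j := fun i j h5 h6 hj x hx =>
    conn_mid_pair (hR i j h5 h6 hj).2 (hR i j h5 h6 hj).1 hx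
  refine loops_eq_card _ ?_ ?_ ?_
  · rintro i ⟨h1, h2, h3⟩ j ⟨h4, h5, h6⟩ hc
    have hB := matchB_of_mem h1 h2
    rw [if_pos h3] at hB
    rcases pair i ⟨i + 1, by omega⟩ h1 h2 hB _ hc with h | h
    · simpa using h.symm
    · have : j.1 = i.1 + 1 := by simpa [Fin.ext_iff] using h
      omega
  · rintro i ⟨h1, h2, h3⟩ v hc
    have hB := matchB_of_mem h1 h2
    rw [if_pos h3] at hB
    rcases pair i ⟨i + 1, by omega⟩ h1 h2 hB _ hc with h | h <;> rcases v with v | v <;>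
      simp [outer] at h
  · intro i
    by_cases hA : matchA f i = i
    · obtain ⟨k, hk⟩ := hathr i hA
      exact Or.inl ⟨.inr k, conn_low hk⟩
    by_cases hBi : matchB f i = i
    · obtain ⟨k, hk⟩ := hbthr i hBi
      exact Or.inl ⟨.inl k, conn_top hk⟩
    rw [matchA_eq_iff hf] at hA
    rw [matchB_eq_iff hf] at hBi
    by_cases h1 : i.1 = 1
    · rw [show i = N 1 (by omega) from Fin.ext h1]
      exact Or.inl ⟨.inl k0, (conn a b).trans ((conn a b).symm (conn_low h01)) (conn_top hk0)⟩
    by_cases h4 : i.1 = 4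
    · rw [show i = N 4 (by omega) from Fin.ext h4]
      exact Or.inl ⟨.inl k3, (conn a b).trans ((conn a b).symm (conn_low h34)) (conn_top hk3)⟩
    have h5 : 5 ≤ i.1 := by omega
    have h6 : i.1 ≤ 2 * f := by omega
    by_cases h7 : i.1 % 2 = 1
    · exact Or.inr ⟨i, ⟨h5, h6, h7⟩, (conn a b).refl _⟩
    · refine Or.inr ⟨⟨i.1 - 1, by omega⟩, ⟨by simp only; omega, by simp only; omega,
        by simp only; omega⟩, conn_low (hR i ⟨i.1 - 1, by omega⟩ h5 h6 ?_).2⟩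
      rw [matchB_of_mem h5 h6, if_neg h7]

/-! ### Non-commutativity -/

/-- The diagram with the upper and lower arcs `matchA`. -/
def diagramA (hf : 2 ≤ f) (hn : 2 * f + 2 ≤ n) : Diagram n :=
  rowDiagram n (matchA f) (matchA f) (fun i hi => ⟨matchA_lt hf hn i hi, matchA_matchA i⟩)
    (fun i hi => ⟨matchA_lt hf hn i hi, matchA_matchA i⟩) fun _ => Iff.rfl

theorem diagramA_mem (hf : 2 ≤ f) (hn : 2 * f + 2 ≤ n) : diagramA hf hn ∈ sameArcs n f := by
  have h : 2 * upperArcs (diagramA hf hn) = 2 * f :=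
    two_mul_upperArcs_rowDiagram.trans (card_matchA hf hn)
  refine ⟨by omega, fun i j => ?_⟩
  rw [diagramA, rowDiagram_inl_iff, rowDiagram_inr_iff]

/-- If `g` is a matching with the same ends as `matchB` that connects the nodes `0`, `2` and the
nodes `3`, `2 f + 1`, then the elements given by the families of `diagramA` and of the diagram with
upper arcs `matchB` and lower arcs `g` do not commute. -/
theorem exists_commutator_not_mem {δ : ℂ} {r : ℕ} (hf : 2 ≤ f) (hn : 2 * f + 2 ≤ n) {g : ℕ → ℕ}
    (hg : ∀ i < n, g i < n ∧ g (g i) = i)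
    (hBg : ∀ i, matchB f i = i ↔ g i = i) (hg1 : g 1 = 2) {b : Diagram n}
    (hb : b = rowDiagram n (matchB f) g (fun i hi => ⟨matchB_lt hf hn i hi, matchB_matchB hf i⟩)
      hg hBg)
    (hc : conn (diagramA hf hn) b (mid ⟨4, by omega⟩) (mid ⟨2 * f + 1, by omega⟩))
    (hr : r ≤ commonNodes b) (w : Diagram n → Diagram n → ℕ) (c : ℂ) (hc0 : c ≠ 0)
    (hw : w (diagramA hf hn) b ≠ 0)
    (h : ∀ a' ∈ sameArcs n f, ∀ b' ∈ sameEnds n f r,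
      (∀ i j : Fin n, a'.line (.inl i) = .inl j ↔ matchA f i = j ∧ matchA f i ≠ i) →
      (∀ i j : Fin n, b'.line (.inl i) = .inl j ↔ matchB f i = j ∧ matchB f i ≠ i) →
      (∀ i j, (comp a' b').line (.inl i) = .inl j → b'.line (.inl i) = .inl j) →
      (∀ i j, (comp a' b').line (.inr i) = .inr j → a'.line (.inr i) = .inr j) →
      δ ^ loops a' b' = w a' b' * c) :
    ∃ x y : Alg n δ, x ∈ centAlg n δ ∧ y ∈ centAlg n δ ∧ x ∈ arcSpan n δ f ∧
      y ∈ arcSpan n δ f ∧ x * y - y * x ∉ arcSpan n δ (f + 1) := by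
  have hA := diagramA_mem hf hn
  have hAinl : ∀ i j, (diagramA hf hn).line (.inl i) = .inl j ↔ matchA f i = j ∧ matchA f i ≠ i :=
    rowDiagram_inl_iff
  have hAinr : ∀ i j, (diagramA hf hn).line (.inr i) = .inr j ↔ matchA f i = j ∧ matchA f i ≠ i :=
    rowDiagram_inr_iff
  have hAthr : ∀ i : Fin n, matchA f i = i → (diagramA hf hn).line (.inl i) = .inr i :=
    fun i hi => rowDiagram_inl_of_eq hi
  have hbinl : ∀ i j, b.line (.inl i) = .inl j ↔ matchB f i = j ∧ matchB f i ≠ i := by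
    subst hb; exact rowDiagram_inl_iff
  have hbinr : ∀ i j, b.line (.inr i) = .inr j ↔ g i = j ∧ g i ≠ i := by
    subst hb; exact rowDiagram_inr_iff
  have hbthr : ∀ i : Fin n, matchB f i = i → b.line (.inl i) = .inr i := by
    subst hb; exact fun i hi => rowDiagram_inl_of_eq hi
  have hbf : upperArcs b = f := by
    have : 2 * upperArcs b = 2 * f := by
      subst hb
      exact two_mul_upperArcs_rowDiagram.trans (card_matchB hf hn)
    omega
  have hB : b ∈ sameEnds n f r := by
    refine ⟨hbf, fun i => ?_, hr⟩
    constructor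
    · rintro ⟨j, hj⟩
      exact ⟨⟨g i, (hg i i.2).1⟩, (hbinr _ _).2 ⟨rfl, fun e => ((hbinl _ _).1 hj).2 ((hBg _).2 e)⟩⟩
    · rintro ⟨j, hj⟩
      exact ⟨⟨matchB f i, matchB_lt hf hn i i.2⟩,
        (hbinl _ _).2 ⟨rfl, fun e => ((hbinr _ _).1 hj).2 ((hBg _).1 e)⟩⟩
  generalize diagramA hf hn = a at *
  let N : (k : ℕ) → k < 2 * f + 2 → Fin n := fun k hk => ⟨k, by omega⟩
  -- The path descends along `b` to the middle node `0`, then follows the arc `{0, 1}` of `a` and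
  -- the arc `{1, 2}` of `b`, and leaves along the through line of `a` at `2`.
  have h0 : (comp a b).line (.inl (N 0 (by omega))) = .inr (N 2 (by omega)) := by
    refine (comp_line_iff _ _ _ _).2 ⟨by simp, ?_⟩
    have e1 := hbthr (N 0 (by omega)) ((matchB_eq_iff hf _).2 (Or.inl rfl))
    have e2 : a.line (.inl (N 0 (by omega))) = .inl (N 1 (by omega)) :=
      (hAinl _ _).2 (by simp [N, matchA])
    have e3 : b.line (.inr (N 1 (by omega))) = .inr (N 2 (by omega)) :=
      (hbinr _ _).2 (by simp [N, hg1])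
    have e4 := hAthr (N 2 (by omega)) ((matchA_eq_iff hf _).2 (Or.inl rfl))
    exact (conn a b).trans (conn_top e1) ((conn a b).trans (conn_low e2)
      ((conn a b).trans (conn_top e3) (conn_low e4)))
  have h3 : (comp a b).line (.inl (N 3 (by omega))) = .inr (N (2 * f + 1) (by omega)) := by
    refine (comp_line_iff _ _ _ _).2 ⟨by simp, ?_⟩
    have e1 := hbthr (N 3 (by omega)) ((matchB_eq_iff hf _).2 (Or.inr (Or.inl rfl)))
    have e2 : a.line (.inl (N 3 (by omega))) = .inl (N 4 (by omega)) :=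
      (hAinl _ _).2 (by simp only [N, matchA]; grind)
    have e4 := hAthr (N (2 * f + 1) (by omega))
      ((matchA_eq_iff hf _).2 (Or.inr (Nat.lt_succ_self _)))
    exact (conn a b).trans (conn_top e1) ((conn a b).trans (conn_low e2)
      ((conn a b).trans hc (conn_low e4)))
  have h6 : ∀ i : Fin n, 2 * f + 1 < i.1 → (comp a b).line (.inl i) = .inr i := by
    intro i hi
    refine (comp_line_iff _ _ _ _).2 ⟨by simp, ?_⟩
    exact (conn a b).trans (conn_top (hbthr i ((matchB_eq_iff hf _).2 (Or.inr (Or.inr hi)))))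
      (conn_low (hAthr i ((matchA_eq_iff hf _).2 (Or.inr (by omega)))))
  have hup0 : ∀ i j, (comp a b).line (.inl i) = .inl j → ∃ k, b.line (.inl i) = .inl k := by
    intro i j hij
    by_contra hno
    have hi : matchB f i = i := by
      by_contra hi
      exact hno ⟨⟨matchB f i, matchB_lt hf hn i i.2⟩, (hbinl _ _).2 ⟨rfl, hi⟩⟩
    rcases (matchB_eq_iff hf _).1 hi with hi | hi | hi
    · rw [show i = N 0 (by omega) from Fin.ext hi, h0] at hij
      cases hij
    · rw [show i = N 3 (by omega) from Fin.ext hi, h3] at hij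
      cases hij
    · rw [h6 i hi] at hij
      cases hij
  have hd : upperArcs (comp a b) = f := by
    have : 2 * upperArcs (comp a b) = 2 * upperArcs b := by
      rw [two_mul_upperArcs, two_mul_upperArcs]
      congr 1
      ext i
      simp only [Finset.mem_filter, Finset.mem_univ, true_and]
      exact ⟨fun ⟨j, hj⟩ => hup0 i j hj, fun ⟨j, hj⟩ => ⟨j, upper_arc_comp a hj⟩⟩
    omega
  -- The pair `{2, 2 f + 1}` is an upper arc, while the lower nodes `2` and `2 f + 1` are joined to
  -- the upper nodes `0` and `3`: the asymmetry required by `commutator_not_mem`.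
  have huv : (comp a b).line (.inl (N 2 (by omega))) = .inl (N (2 * f + 1) (by omega)) :=
    upper_arc_comp a ((hbinl _ _).2 (by
      have : matchB f 2 = 2 * f + 1 := by simp [matchB]
      refine ⟨this, ?_⟩
      change matchB f 2 ≠ 2
      omega))
  refine commutator_not_mem hA hB hd huv (by rw [← h0, (comp a b).line_line])
    (by rw [← h3, (comp a b).line_line]) w c hc0 hw fun a' ha' b' hb' e => ?_
  have hupd := @upper_arc_iff _ a b (hd.trans hbf.symm)
  have hlowd := @lower_arc_iff _ a b (hd.trans hA.1.symm)
  have hup' := @upper_arc_iff _ a' b' (by rw [e, hd, hb'.1])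
  have hlow' := @lower_arc_iff _ a' b' (by rw [e, hd, ha'.1])
  -- For any pair with the same product, the lower arcs of `a'` and the upper arcs of `b'` are read
  -- off from the product; the upper arcs of `a'` then agree with its lower ones.
  refine h a' ha' b' hb' (fun i j => ?_) (fun i j => ?_) (fun i j => hup'.1) (fun i j => hlow'.1)
  · rw [ha'.2, ← hlow', e, hlowd, hAinr]
  · rw [← hup', e, hupd, hbinl]

/-- `matchC` shares the arcs `{5, 6}, …, {2 f - 1, 2 f}` with `matchB`, hence the threshold `r = 2 f
- 4`. It forces every contributing pair to have the same number of loops, so the coefficient is a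
positive integer times a fixed power of `δ`. -/
theorem exists_commutator_not_mem_of_ne_zero {δ : ℂ} (hδ : δ ≠ 0) (hf : 2 ≤ f)
    (hn : 2 * f + 2 ≤ n) :
    ∃ x y : Alg n δ, x ∈ centAlg n δ ∧ y ∈ centAlg n δ ∧ x ∈ arcSpan n δ f ∧
      y ∈ arcSpan n δ f ∧ x * y - y * x ∉ arcSpan n δ (f + 1) := by
  refine exists_commutator_not_mem (r := 2 * f - 4) hf hn (g := matchC f)
    (fun i hi => ⟨matchC_lt hf hn i hi, matchC_matchC hf i⟩)
    (fun i => (matchB_eq_iff hf i).trans (matchC_eq_iff hf i).symm) (by simp [matchC]) rfl ?_ ?_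
    (fun _ _ => 1) (δ ^ Nat.card {i : Fin n | 5 ≤ i.1 ∧ i.1 ≤ 2 * f ∧ i.1 % 2 = 1})
    (pow_ne_zero _ hδ) one_ne_zero ?_
  · refine conn_top (v := .inr _) (w := .inr _) ((rowDiagram_inr_iff _ _).2 ⟨?_, ?_⟩)
    · simp [matchC]
    · simp only [matchC]; grind
  · have : ((Finset.range n).filter fun i => 5 ≤ i ∧ i ≤ 2 * f) = Finset.Icc 5 (2 * f) := by
      ext i
      simp only [Finset.mem_filter, Finset.mem_range, Finset.mem_Icc]
      omega
    have hcard : (Finset.univ.filter fun i : Fin n => 5 ≤ i.1 ∧ i.1 ≤ 2 * f).card = 2 * f - 4 := by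
      rw [card_filter_fin (fun i => 5 ≤ i ∧ i ≤ 2 * f), this, Nat.card_Icc]
      omega
    rw [← hcard]
    refine Finset.card_le_card fun i hi => ?_
    obtain ⟨h5, h6⟩ := (Finset.mem_filter.1 hi).2
    have hB : matchB f i ≠ i := by rw [Ne, matchB_eq_iff hf]; omega
    have hC : matchC f i ≠ i := by rw [Ne, matchC_eq_iff hf]; omega
    exact Finset.mem_filter.2 ⟨Finset.mem_univ _, ⟨matchB f i, matchB_lt hf hn i i.2⟩,
      (rowDiagram_inl_iff _ _).2 ⟨rfl, hB⟩, (rowDiagram_inr_iff _ _).2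
        ⟨by rw [matchC_of_mem h5 h6, ← matchB_of_mem h5 h6], hC⟩⟩
  · intro a _ b hb h1 h2 h3 h4
    rw [loops_eq_of_commonNodes hf hn h1 h2 hb.2.1 hb.2.2 h3 h4, Nat.cast_one, one_mul]

/-- A loop would kill the contribution when `δ = 0`. So `matchD` is shifted by one against `matchA`:
from `4` on, their arcs alternate along one path to `2 f + 1`, and the chosen pair has no loop. -/
theorem exists_commutator_not_mem_of_eq_zero (hf : 2 ≤ f) (hn : 2 * f + 2 ≤ n) :
    ∃ x y : Alg n 0, x ∈ centAlg n 0 ∧ y ∈ centAlg n 0 ∧ x ∈ arcSpan n 0 f ∧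
      y ∈ arcSpan n 0 f ∧ x * y - y * x ∉ arcSpan n 0 (f + 1) := by
  classical
  have hg : ∀ i < n, matchD f i < n ∧ matchD f (matchD f i) = i :=
    fun i hi => ⟨matchD_lt hf hn i hi, matchD_matchD i⟩
  have hBg : ∀ i, matchB f i = i ↔ matchD f i = i :=
    fun i => (matchB_eq_iff hf i).trans (matchD_eq_iff hf i).symm
  obtain ⟨b, hb⟩ : ∃ b : Diagram n, b = rowDiagram n (matchB f) (matchD f)
    (fun i hi => ⟨matchB_lt hf hn i hi, matchB_matchB hf i⟩) hg hBg := ⟨_, rfl⟩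
  have hbinr : ∀ i j, b.line (.inr i) = .inr j ↔ matchD f i = j ∧ matchD f i ≠ i := by
    subst hb; exact rowDiagram_inr_iff
  have hbthr : ∀ i : Fin n, matchD f i = i → b.line (.inr i) = .inl i := by
    subst hb; exact fun i hi => rowDiagram_inr_of_eq hi
  have hAinl : ∀ i j, (diagramA hf hn).line (.inl i) = .inl j ↔ matchA f i = j ∧ matchA f i ≠ i :=
    rowDiagram_inl_iff
  have hAthr : ∀ i : Fin n, matchA f i = i → (diagramA hf hn).line (.inl i) = .inr i :=
    fun i hi => rowDiagram_inl_of_eq hi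
  let N : (k : ℕ) → k < 2 * f + 2 → Fin n := fun k hk => ⟨k, by omega⟩
  -- From `k` to `k + 1` an arc of `matchD` is used for even `k` and an arc of `matchA` for odd `k`.
  have chain : ∀ k (hk : k < 2 * f + 2), 4 ≤ k →
      conn (diagramA hf hn) b (mid (N 4 (by omega))) (mid (N k hk)) := by
    intro k hk h4
    induction k, h4 using Nat.le_induction with
    | base => exact Setoid.refl' _ _
    | succ k h4 ih =>
      refine Setoid.trans' _ (ih (by omega)) ?_
      rcases Nat.even_or_odd k with ⟨l, hl⟩ | ⟨l, hl⟩
      · refine conn_top (v := .inr _) (w := .inr _) ((hbinr _ _).2 ?_)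
        simp only [N, matchD]
        grind
      · refine conn_low (v := .inl _) (w := .inl _) ((hAinl _ _).2 ?_)
        simp only [N, matchA]
        grind
  have hloops : loops (diagramA hf hn) b = 0 := by
    rw [loops_eq_card (∅ : Set (Fin n)) (by simp) (by simp), Nat.card_eq_zero]
    · exact Or.inl inferInstance
    intro i
    left
    by_cases hA : matchA f i = i
    · exact ⟨.inr i, conn_low (hAthr i hA)⟩
    by_cases hD : matchD f i = i
    · exact ⟨.inl i, conn_top (hbthr i hD)⟩
    rw [matchA_eq_iff hf] at hA
    rw [matchD_eq_iff hf] at hD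
    by_cases h1 : i.1 = 1
    · refine ⟨.inl (N 0 (by omega)), Setoid.trans' _ (conn_low (v := .inl _)
        (w := .inl (N 0 (by omega))) ((hAinl _ _).2 (by simp [N, matchA, h1])))
        (conn_top (hbthr _ ((matchD_eq_iff hf _).2 (Or.inl rfl))))⟩
    · have h4 := chain i.1 (by omega) (by omega)
      refine ⟨.inl (N 3 (by omega)), Setoid.trans' _ (Setoid.symm' _ h4) (Setoid.trans' _
        (conn_low (v := .inl _) (w := .inl (N 3 (by omega))) ((hAinl _ _).2 ?_))
        (conn_top (hbthr _ ((matchD_eq_iff hf _).2 (Or.inr (Or.inl rfl))))))⟩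
      simp only [N, matchA]
      grind
  -- Powers of `0` are `1` for no loops and `0` otherwise, so the weight is the indicator of
  -- loop-free pairs and no condition on common arcs is needed.
  refine exists_commutator_not_mem (r := 0) hf hn hg hBg (by simp [matchD]) hb
    (chain _ (by omega) (by omega)) (Nat.zero_le _) (fun a b => if loops a b = 0 then 1 else 0) 1
    one_ne_zero (by simp [hloops]) fun a _ b _ _ _ _ _ => ?_
  by_cases h : loops a b = 0 <;> simp [h]

/-! ### From commutators to the algebras in the statement -/

theorem exists_commutator (δ : ℂ) (hf : 2 ≤ f) (hn : 2 * f + 2 ≤ n) :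
    ∃ x y : Alg n δ, x ∈ centAlg n δ ∧ y ∈ centAlg n δ ∧ x ∈ arcSpan n δ f ∧
      y ∈ arcSpan n δ f ∧ x * y - y * x ∉ arcSpan n δ (f + 1) := by
  by_cases hδ : δ = 0
  · subst hδ; exact exists_commutator_not_mem_of_eq_zero hf hn
  · exact exists_commutator_not_mem_of_ne_zero hδ hf hn

theorem quotient_comm_iff (δ : ℂ) (n f : ℕ) :
    (∀ x y : CentQuotient n δ f, x * y = y * x) ↔
      ∀ x ∈ centAlg n δ, ∀ y ∈ centAlg n δ, x * y - y * x ∈ arcSpan n δ f := by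
  have key : ∀ x y : centAlg n δ, ((x * y : centAlg n δ) : CentQuotient n δ f) = (y * x : centAlg n δ) ↔
      (x * y - y * x : Alg n δ) ∈ arcSpan n δ f := by
    intro x y
    rw [RingCon.eq, TwoSidedIdeal.rel_iff, centIdeal, TwoSidedIdeal.mem_comap, mem_arcIdeal]
    rfl
  constructor
  · intro h x hx y hy
    exact (key ⟨x, hx⟩ ⟨y, hy⟩).1 (h ((⟨x, hx⟩ : centAlg n δ) : CentQuotient n δ f)
      ((⟨y, hy⟩ : centAlg n δ) : CentQuotient n δ f))
  · intro h x y
    induction x using Quotient.inductionOn with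
    | h x =>
      induction y using Quotient.inductionOn with
      | h y => exact (key x y).2 (h x x.2 y y.2)

end Brauer

theorem mainTheorem8 (δ : ℂ) (n : ℕ) :
    (n ≤ 5 → ∀ x y : Brauer.centAlg n δ, x * y = y * x) ∧
    (6 ≤ n → ¬ ∀ x y : Brauer.centAlg n δ, x * y = y * x) ∧
    (6 ≤ n →
      (∀ f, 1 ≤ f → f ≤ 2 → ∀ x y : Brauer.CentQuotient n δ f, x * y = y * x) ∧
      (∀ f, 3 ≤ f → f ≤ n / 2 → ¬ ∀ x y : Brauer.CentQuotient n δ f, x * y = y * x) ∧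
      (∀ x y : Brauer.centInter n δ (n / 2), x * y = y * x) ∧
      (∀ f, f < n / 2 → ¬ ∀ x y : Brauer.centInter n δ f, x * y = y * x)) := by
  open Brauer in
  refine ⟨fun hn x y => Subtype.ext (mul_comm_of_le_five hn x.2 y.2), fun hn h => ?_, fun hn =>
    ⟨fun f _ hf => (quotient_comm_iff δ n f).2 fun x hx y hy =>
      arcSpan_antitone hf (commutator_mem_arcSpan_two hx hy), fun f hf _ h => ?_,
      fun x y => Subtype.ext (mul_comm_of_mem_centInter x.2 y.2), fun f hf h => ?_⟩⟩
  · obtain ⟨x, y, hx, hy, -, -, hxy⟩ := exists_commutator (n := n) δ le_rfl (by omega)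
    have := congrArg Subtype.val (h ⟨x, hx⟩ ⟨y, hy⟩)
    exact hxy (by rw [show x * y = y * x from this, sub_self]; exact Submodule.zero_mem _)
  -- For `f = 2` the commutator is not in `J^(3)`, which contains `J^(f)` for every `f ≥ 3`.
  · obtain ⟨x, y, hx, hy, -, -, hxy⟩ := exists_commutator (n := n) δ le_rfl (by omega)
    exact hxy (arcSpan_antitone hf ((quotient_comm_iff δ n f).1 h x hx y hy))
  -- The witnesses lie in `J^(⌊n/2⌋ - 1)`, hence in every larger ideal `J^(f)` with `f < ⌊n/2⌋`.
  · obtain ⟨x, y, hx, hy, hx', hy', hxy⟩ :=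
      exists_commutator (n := n) (f := n / 2 - 1) δ (by omega) (by omega)
    have hle : f ≤ n / 2 - 1 := by omega
    have := congrArg Subtype.val (h
      ⟨x, hx, (mem_arcIdeal x).2 (arcSpan_antitone hle hx')⟩
      ⟨y, hy, (mem_arcIdeal y).2 (arcSpan_antitone hle hy')⟩)
    exact hxy (by rw [show x * y = y * x from this, sub_self]; exact Submodule.zero_mem _)
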